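/- Let $\mathcal A$ be a pointed, Barr-exact, (Bourn-)protomodular category and let $\mathcal B\subseteq\mathcal A$ be a Birkhoff subcategory, that is, a full reflective subcategory closed under subobjects and regular quotients, with reflector $I$ and unit $\eta\colon 1_{\mathcal A}\Rightarrow I$. Notation. Put $\mathsf{Arr}^0\mathcal A=\mathcal A$ and $\mathsf{Arr}^{k+1}\mathcal A=\mathsf{Arr}(\mathsf{Arr}^k\mathcal A)$. A $0$-extension is an object of $\mathcal A$, a $1$-extension is a regular epimorphism of $\mathcal A$, and, for $k\ge 2$, a $k$-extension is a $k$-dimensional arrow, viewed as a commutative square of $(k-2)$-dimensional arrows, whose four sides and whose comparison map to the induced pullback are $(k-1)$-extensions. $\mathsf{Ext}^k\mathcal A$ is the full subcategory of $\mathsf{Arr}^k\mathcal A$ on the $k$-extensions, and $\mathrm{cod},\ker\colon \mathsf{Ext}^{k+1}\mathcal A\to\mathsf{Ext}^k\mathcal A$ are the codomain and kernel functors. Put $I_0=I$, $J_0X=K[\eta_X]$, and let $\mu^0\colon J_0\Rightarrow 1_{\mathcal A}$ be the inclusion. Inductively, for a $(k+1)$-extension $f\colon X\to Y$ with kernel pair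 $\pi_1,\pi_2\colon R[f]\to X$, let $J_{k+1}f\colon K[J_k\pi_1]\to 0$, let $\mu^{k+1}_f\colon J_{k+1}f\to f$ be given by $\mu^k_X\circ J_k\pi_2\circ \mathrm{Ker}(J_k\pi_1)\colon K[J_k\pi_1]\to X$, and let $I_{k+1}f\colon \mathrm{Coker}\bigl(\mu^k_X\circ J_k\pi_2\circ\mathrm{Ker}(J_k\pi_1)\bigr)\to Y$ be induced by $f$. This defines functors $I_k\colon\mathsf{Ext}^k\mathcal A\to\mathsf{Ext}^k\mathcal A$ for all $k\ge0$. Homology. Put $H_1(-,I_k)=I_k$ for $k\ge 0$. For $n\ge1$, when $H_n(-,I_{k+1})$ exists, $H_{n+1}(-,I_k)\colon\mathsf{Ext}^k\mathcal A\to\mathsf{Ext}^k\mathcal A$ is, if it exists, the pointwise right Kan extension of $\ker\circ H_n(-,I_{k+1})$ along $\mathrm{cod}\colon\mathsf{Ext}^{k+1}\mathcal A\to\mathsf{Ext}^k\mathcal A$. Statement. Let $A$ be an object of $\mathcal A$ and $n\ge 0$. 1. If the homology functor $H_{n+1}(-,I)=H_{n+1}(-,I_0)$ exists, then $H_{n+1}(A,I)$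 is an object of $\mathcal B$. 2. More generally, if the limit of the diagram $$(A\downarrow\mathrm{cod}^n)\xrightarrow{\;U\;}\mathsf{Ext}^{n}\mathcal A\xrightarrow{\;I_n\;}\mathsf{Ext}^n\mathcal A\xrightarrow{\;\ker^n\;}\mathcal A$$ exists for this object $A$, where $U$ is the forgetful functor (this limit is $H_{n+1}(A,I)$ for the single object $A$, whether or not the homology functors exist in full), then it is an object of $\mathcal B$. -/

import Mathlib

open CategoryTheory CategoryTheory.Limits ZeroObject

universe v u

namespace SatelliteHomology

section Context

variable (C : Type u) [Category.{v} C]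

/-- A Barr-exact category: a regular category (in particular, with finite limits) in which every
internal equivalence relation is effective, that is, the kernel pair of its coequalizer. -/
class BarrExact : Prop extends Regular C where
  effective {R X : C} (p₁ p₂ : R ⟶ X) [IsEquivalenceRelation p₁ p₂] :
    IsEffectiveEquivalenceRelation p₁ p₂

/-- Bourn protomodularity: every change of base functor `v^* : Pt_Y C ⥤ Pt_Z C` of the fibration of
points reflects isomorphisms. A point over `Y` is a map `p : X ⟶ Y` with a section `s`, and
a morphism of points is a map `φ` over `Y` that is compatible with the sections. -/
class Protomodular [HasPullbacks C] : Prop where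
  isIso_of_isIso_pullback {X X' Y Z : C} (p : X ⟶ Y) (s : Y ⟶ X) (p' : X' ⟶ Y) (s' : Y ⟶ X')
    (_ : s ≫ p = 𝟙 Y) (_ : s' ≫ p' = 𝟙 Y) (φ : X ⟶ X') (hp : φ ≫ p' = p) (_ : s ≫ φ = s')
    (v : Z ⟶ Y)
    (_ : IsIso (pullback.map p v p' v φ (𝟙 Z) (𝟙 Y) (by simp [hp]) (by simp))) : IsIso φ

end Context

/-- A Birkhoff subcategory of `C`, given by the class `B` of its objects: a full reflective
subcategory that is closed under subobjects and regular quotients. -/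
class Birkhoff {C : Type u} [Category.{v} C] (B : ObjectProperty C)
    extends Reflective B.ι where
  of_mono {X Y : C} (m : X ⟶ Y) [Mono m] : B Y → B X
  of_regularEpi {X Y : C} (q : X ⟶ Y) [IsRegularEpi q] : B X → B Y

section Exactness

attribute [local simp] pullback.lift_fst pullback.lift_snd pullback.lift_fst_assoc
  pullback.lift_snd_assoc prod.lift_fst prod.lift_snd equalizer.lift_ι equalizer.lift_ι_assoc

variable {C : Type u} [Category.{v} C]

/-- In a pullback of a split epimorphism, the section and the pulled back map are jointly
strongly epimorphic. -/
theorem isIso_of_factors [HasPullbacks C] [Protomodular C] {X Y Z U : C} (p : X ⟶ Y) (s : Y ⟶ X)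
    (hs : s ≫ p = 𝟙 Y) (v : Z ⟶ Y) (m : U ⟶ X) [Mono m] (a : Y ⟶ U) (ha : a ≫ m = s)
    (b : pullback p v ⟶ U) (hb : b ≫ m = pullback.fst p v) : IsIso m := by
  refine Protomodular.isIso_of_isIso_pullback (m ≫ p) a p s (by rw [← Category.assoc, ha, hs]) hs
    m rfl ha v ?_
  have e : b ≫ m ≫ p = pullback.snd p v ≫ v := by
    rw [← Category.assoc, hb, pullback.condition]
  refine ⟨pullback.lift b (pullback.snd p v) e, ?_, ?_⟩
  · apply pullback.hom_ext
    · rw [← cancel_mono m]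
      simp [pullback.map, hb]
    · simp [pullback.map]
  · apply pullback.hom_ext
    · simp [pullback.map, hb]
    · simp [pullback.map]

theorem eq_of_factors [HasFiniteLimits C] [Protomodular C] {X Y Z W : C} (p : X ⟶ Y) (s : Y ⟶ X)
    (hs : s ≫ p = 𝟙 Y) (v : Z ⟶ Y) (f g : X ⟶ W) (h₁ : s ≫ f = s ≫ g)
    (h₂ : pullback.fst p v ≫ f = pullback.fst p v ≫ g) : f = g := by
  have := isIso_of_factors p s hs v (equalizer.ι f g) (equalizer.lift s h₁) (by simp)
    (equalizer.lift _ h₂) (by simp)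
  rw [← cancel_epi (equalizer.ι f g), equalizer.condition]

theorem rel_of_factors [HasFiniteLimits C] [Protomodular C] {X Y Z R W : C} (p : X ⟶ Y)
    (s : Y ⟶ X) (hs : s ≫ p = 𝟙 Y) (v : Z ⟶ Y) (r₁ r₂ : R ⟶ W) (hr : JointlyMono₂ r₁ r₂)
    (x y : X ⟶ W) (h₁ : ∃ t, t ≫ r₁ = s ≫ x ∧ t ≫ r₂ = s ≫ y)
    (h₂ : ∃ t, t ≫ r₁ = pullback.fst p v ≫ x ∧ t ≫ r₂ = pullback.fst p v ≫ y) :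
    ∃ t, t ≫ r₁ = x ∧ t ≫ r₂ = y := by
  obtain ⟨t₁, a₁, b₁⟩ := h₁
  obtain ⟨t₂, a₂, b₂⟩ := h₂
  have hm : Mono (prod.lift r₁ r₂) := ⟨fun f g h => by
    apply hr.right_cancellation
    · simpa using h =≫ prod.fst
    · simpa using h =≫ prod.snd⟩
  have := isIso_of_factors p s hs v (pullback.fst (prod.lift x y) (prod.lift r₁ r₂))
    (pullback.lift s t₁ (by ext <;> simp [a₁, b₁])) (by simp)
    (pullback.lift (pullback.fst p v) t₂ (by ext <;> simp [a₂, b₂])) (by simp)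
  have hc := pullback.condition (f := prod.lift x y) (g := prod.lift r₁ r₂)
  refine ⟨inv (pullback.fst (prod.lift x y) (prod.lift r₁ r₂)) ≫ pullback.snd _ _, ?_, ?_⟩
  · have := hc =≫ prod.fst
    simp only [Category.assoc, prod.lift_fst] at this
    simp [← this]
  · have := hc =≫ prod.snd
    simp only [Category.assoc, prod.lift_snd] at this
    simp [← this]

/-- Protomodular categories are Mal'tsev: reflexive relations are difunctional. -/
theorem difunctional [HasFiniteLimits C] [Protomodular C] {R X T : C} {r₁ r₂ : R ⟶ X}
    (hr : ReflexiveRelation r₁ r₂) (a b c : T ⟶ R) (h₁ : a ≫ r₂ = b ≫ r₂)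
    (h₂ : b ≫ r₁ = c ≫ r₁) : ∃ t, t ≫ r₁ = a ≫ r₁ ∧ t ≫ r₂ = c ≫ r₂ := by
  let P := pullback (pullback.snd r₂ r₂) (pullback.fst r₁ r₁)
  let fst : P ⟶ pullback r₂ r₂ := pullback.fst _ _
  let snd : P ⟶ pullback r₁ r₁ := pullback.snd _ _
  have hP : fst ≫ pullback.snd r₂ r₂ = snd ≫ pullback.fst r₁ r₁ := pullback.condition
  have key : ∃ t, t ≫ r₁ = fst ≫ pullback.fst r₂ r₂ ≫ r₁ ∧
      t ≫ r₂ = snd ≫ pullback.snd r₁ r₁ ≫ r₂ := by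
    let s : pullback r₁ r₁ ⟶ P := pullback.lift
      (pullback.lift (pullback.fst r₁ r₁) (pullback.fst r₁ r₁) rfl) (𝟙 _) (by simp)
    refine rel_of_factors snd s (by simp [s, snd]) (pullback.lift (𝟙 R) (𝟙 R) rfl) r₁ r₂
      hr.toJointlyMono₂ _ _ ⟨pullback.snd r₁ r₁, ?_, ?_⟩ ⟨pullback.fst snd
        (pullback.lift (𝟙 R) (𝟙 R) rfl) ≫ fst ≫ pullback.fst r₂ r₂, by simp, ?_⟩
    · simp [s, fst, pullback.condition]
    · simp [s, snd]
    · have hc := pullback.condition (f := snd) (g := pullback.lift (𝟙 R) (𝟙 R) rfl)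
      have e₁ : pullback.fst snd _ ≫ snd ≫ pullback.fst r₁ r₁ =
          pullback.snd snd (pullback.lift (𝟙 R) (𝟙 R) rfl) := by
        simpa using hc =≫ pullback.fst r₁ r₁
      have e₂ : pullback.fst snd _ ≫ snd ≫ pullback.snd r₁ r₁ =
          pullback.snd snd (pullback.lift (𝟙 R) (𝟙 R) rfl) := by
        simpa using hc =≫ pullback.snd r₁ r₁
      rw [← hP] at e₁
      simp only [Category.assoc]
      rw [pullback.condition, reassoc_of% e₁, reassoc_of% e₂]
  obtain ⟨t, ht₁, ht₂⟩ := key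
  let e : T ⟶ P := pullback.lift (pullback.lift a b h₁) (pullback.lift b c h₂) (by simp)
  exact ⟨e ≫ t, by simp [ht₁, e, fst], by simp [ht₂, e, snd]⟩

theorem isEquivalenceRelation [HasFiniteLimits C] [Protomodular C] {R X : C} {r₁ r₂ : R ⟶ X}
    (hr : ReflexiveRelation r₁ r₂) : IsEquivalenceRelation r₁ r₂ := by
  obtain ⟨s, hs₁, hs₂⟩ := difunctional hr (r₂ ≫ hr.r) (𝟙 R) (r₁ ≫ hr.r) (by simp) (by simp)
  obtain ⟨t, ht₁, ht₂⟩ := difunctional hr (pullback.fst r₂ r₁) (pullback.fst r₂ r₁ ≫ r₂ ≫ hr.r)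
    (pullback.snd r₂ r₁) (by simp) (by simp [pullback.condition])
  exact ⟨⟨{ hr with
    s := s
    symmetry₁ := by simpa using hs₁
    symmetry₂ := by simpa using hs₂
    c := pullback.cone r₂ r₁
    isLimit := pullback.isLimit r₂ r₁
    t := t
    transitivity₁ := ht₁
    transitivity₂ := ht₂ }⟩⟩

/-- `n` is a kernel of `f`. -/
def IsKer {C : Type u} [Category.{v} C] [HasZeroMorphisms C] {N X Y : C} (n : N ⟶ X) (f : X ⟶ Y) :
    Prop :=
  n ≫ f = 0 ∧ ∀ ⦃T : C⦄ (t : T ⟶ X), t ≫ f = 0 → ∃! t' : T ⟶ N, t' ≫ n = t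

/-- `q` is a cokernel of `f`. -/
def IsCoker {C : Type u} [Category.{v} C] [HasZeroMorphisms C] {X Y Q : C} (f : X ⟶ Y)
    (q : Y ⟶ Q) : Prop :=
  f ≫ q = 0 ∧ ∀ ⦃T : C⦄ (t : Y ⟶ T), f ≫ t = 0 → ∃! t' : Q ⟶ T, q ≫ t' = t

/-- In group-like terms: for a reflexive relation `R` on `B` and the kernel `M` of a map `h` on `R`,
the set of all `b` with `(0, b) ∈ M` is a normal subobject of `B`, and it has a cokernel. -/
def HasNormalImages (C : Type u) [Category.{v} C] [HasZeroMorphisms C] : Prop :=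
  ∀ ⦃R B Z N : C⦄ (π₁ π₂ : R ⟶ B) (δ : B ⟶ R) (h : R ⟶ Z) (n : N ⟶ R), JointlyMono₂ π₁ π₂ →
    δ ≫ π₁ = 𝟙 B → δ ≫ π₂ = 𝟙 B → n ≫ π₁ = 0 → n ≫ h = 0 →
    (∀ ⦃T : C⦄ (t : T ⟶ R), t ≫ π₁ = 0 → t ≫ h = 0 → ∃! t' : T ⟶ N, t' ≫ n = t) →
    ∃ (Q : C) (q : B ⟶ Q), IsCoker (n ≫ π₂) q ∧ IsKer (n ≫ π₂) q

theorem hasNormalImages [HasZeroMorphisms C] [BarrExact C] [Protomodular C]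
    [HasZeroObject C] : HasNormalImages C := by
  intro R B Z N π₁ π₂ δ h n hπ h₁ h₂ hn₁ hnh hN
  let e := equalizer.ι h (π₁ ≫ δ ≫ h)
  have he : e ≫ h = e ≫ π₁ ≫ δ ≫ h := equalizer.condition _ _
  have hr : ReflexiveRelation (e ≫ π₁) (e ≫ π₂) :=
    { right_cancellation := fun T f g a b => by
        rw [← cancel_mono e]
        exact hπ.right_cancellation _ _ (by simpa using a) (by simpa using b)
      r := equalizer.lift δ (by simp [reassoc_of% h₁])
      reflexivity₁ := by simp [e, h₁]
      reflexivity₂ := by simp [e, h₂] }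
  have hrr : hr.r ≫ e ≫ π₁ = 𝟙 B := hr.reflexivity₁
  have hrr' : hr.r ≫ e ≫ π₂ = 𝟙 B := hr.reflexivity₂
  have := isEquivalenceRelation hr
  obtain ⟨⟨E⟩⟩ := BarrExact.effective (e ≫ π₁) (e ≫ π₂)
  have hE : e ≫ π₁ ≫ E.π = e ≫ π₂ ≫ E.π := by simpa using E.isKernelPair.w
  have hw : (n ≫ π₂) ≫ E.π = 0 := by
    obtain ⟨n', hn'⟩ : ∃ n' : N ⟶ _, n' ≫ e = n :=
      ⟨equalizer.lift n (by rw [reassoc_of% hn₁, hnh, zero_comp]), by simp [e]⟩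
    rw [Category.assoc, ← hn', Category.assoc, ← hE, reassoc_of% hn', reassoc_of% hn₁, zero_comp]
  refine ⟨E.B, E.π, ⟨hw, fun W g hg => ?_⟩, ⟨hw, fun T t ht => ?_⟩⟩
  · have hd : (e ≫ π₁) ≫ g = (e ≫ π₂) ≫ g := by
      refine eq_of_factors (e ≫ π₁) hr.r hrr (0 : (0 : C) ⟶ B) _ _ ?_ ?_
      · simp only [Category.assoc]
        rw [reassoc_of% hrr, reassoc_of% hrr']
      · set κ := pullback.fst (e ≫ π₁) (0 : (0 : C) ⟶ B)
        have hκ : κ ≫ e ≫ π₁ = 0 := by simp [κ, pullback.condition]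
        obtain ⟨k, hk, -⟩ := hN (κ ≫ e) (by simpa using hκ)
          (by rw [Category.assoc, he, reassoc_of% hκ, zero_comp])
        simp only [Category.assoc] at hg ⊢
        rw [reassoc_of% hκ, zero_comp, ← reassoc_of% hk, hg, comp_zero]
    exact ⟨Cofork.IsColimit.desc E.isCoequalizer g hd,
      Cofork.IsColimit.π_desc' E.isCoequalizer g hd, fun m hm =>
      Cofork.IsColimit.hom_ext E.isCoequalizer
        (hm.trans (Cofork.IsColimit.π_desc' E.isCoequalizer g hd).symm)⟩
  · let t₁ := E.isKernelPair.lift 0 t (by rw [ht, zero_comp])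
    have a : t₁ ≫ e ≫ π₁ = 0 := E.isKernelPair.lift_fst _ _ _
    have b : t₁ ≫ e ≫ π₂ = t := E.isKernelPair.lift_snd _ _ _
    obtain ⟨k, hk, -⟩ := hN (t₁ ≫ e) (by simpa using a)
      (by rw [Category.assoc, he, reassoc_of% a, zero_comp])
    have hk' : k ≫ n ≫ π₂ = t := by rw [reassoc_of% hk, b]
    refine ⟨k, hk', fun m hm => ?_⟩
    have : m ≫ n = k ≫ n := hπ.right_cancellation _ _ (by simp [hn₁]) (by
      simp only [Category.assoc]
      exact hm.trans hk'.symm)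
    obtain ⟨k', -, hk'⟩ := hN (m ≫ n) (by simp [hn₁]) (by simp [hnh])
    rw [hk' m rfl, hk' _ this.symm]

end Exactness

section ArrowZero

variable {C : Type u} [Category.{v} C]

theorem exists_hom_left (X : Arrow C) {T : C} (t : T ⟶ X.left) :
    ∃ t' : Arrow.mk (𝟙 T) ⟶ X, t'.left = t :=
  ⟨Arrow.homMk t (t ≫ X.hom) (by simp), rfl⟩

theorem ext_left (X : Arrow C) {T : C} (s t : Arrow.mk (𝟙 T) ⟶ X) (h : s.left = t.left) :
    s = t := by
  refine Arrow.hom_ext _ _ h ?_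
  have a : s.left ≫ X.hom = 𝟙 T ≫ s.right := Arrow.w s
  have b : t.left ≫ X.hom = 𝟙 T ≫ t.right := Arrow.w t
  rw [Category.id_comp] at a b
  exact a.symm.trans ((congrArg (· ≫ X.hom) h).trans b)

variable [HasZeroMorphisms C]

instance arrowHasZeroMorphisms : HasZeroMorphisms (Arrow C) where
  zero f g := ⟨Arrow.homMk 0 0 (by simp)⟩
  comp_zero _ _ := Arrow.hom_ext _ _ comp_zero comp_zero
  zero_comp _ _ _ _ := Arrow.hom_ext _ _ zero_comp zero_comp

@[simp] theorem arrow_zero_left (f g : Arrow C) : (0 : f ⟶ g).left = 0 := rfl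

@[simp] theorem arrow_zero_right (f g : Arrow C) : (0 : f ⟶ g).right = 0 := rfl

instance arrowHasZeroObject [HasZeroObject C] : HasZeroObject (Arrow C) :=
  ⟨Arrow.mk (0 : (0 : C) ⟶ 0),
    ⟨fun _ => ⟨⟨⟨0⟩, fun _ => Arrow.hom_ext _ _ ((isZero_zero C).eq_of_src _ _)
      ((isZero_zero C).eq_of_src _ _)⟩⟩,
    fun _ => ⟨⟨⟨0⟩, fun _ => Arrow.hom_ext _ _ ((isZero_zero C).eq_of_tgt _ _)
      ((isZero_zero C).eq_of_tgt _ _)⟩⟩⟩⟩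

/-- The functor that sends `X` to the arrow `X ⟶ 0`. -/
noncomputable def toZero (C : Type u) [Category.{v} C] [HasZeroMorphisms C] [HasZeroObject C] :
    C ⥤ Arrow C where
  obj X := Arrow.mk (0 : X ⟶ (0 : C))
  map f := Arrow.homMk f (𝟙 _) (by simp)

theorem exists_hom_right [HasZeroObject C] (X : Arrow C) {T : C} (t : T ⟶ X.right) :
    ∃ t' : Arrow.mk (0 : (0 : C) ⟶ T) ⟶ X, t'.right = t :=
  ⟨Arrow.homMk 0 t (by simp), rfl⟩

theorem ext_right [HasZeroObject C] (X : Arrow C) {T : C}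
    (s t : Arrow.mk (0 : (0 : C) ⟶ T) ⟶ X) (h : s.right = t.right) : s = t :=
  Arrow.hom_ext _ _ ((isZero_zero C).eq_of_src _ _) h

theorem isKer_arrow {N X Y : Arrow C} (n : N ⟶ X) (f : X ⟶ Y) (hl : IsKer n.left f.left)
    (hr : IsKer n.right f.right) : IsKer n f := by
  refine ⟨Arrow.hom_ext _ _ hl.1 hr.1, fun T t ht => ?_⟩
  obtain ⟨a, ha, ha'⟩ := hl.2 t.left (congrArg CommaMorphism.left ht)
  obtain ⟨b, hb, hb'⟩ := hr.2 t.right (congrArg CommaMorphism.right ht)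
  have hw : a ≫ N.hom = T.hom ≫ b := by
    refine (hr.2 (T.hom ≫ t.right) ?_).unique ?_ ?_
    · rw [Category.assoc, ← Arrow.comp_right, ht, arrow_zero_right, comp_zero]
    · rw [Category.assoc, ← Arrow.w n, reassoc_of% ha, Arrow.w t]
    · rw [Category.assoc, hb]
  exact ⟨Arrow.homMk a b hw, Arrow.hom_ext _ _ ha hb, fun y hy => Arrow.hom_ext _ _
    (ha' _ (congrArg CommaMorphism.left hy)) (hb' _ (congrArg CommaMorphism.right hy))⟩

theorem hasNormalImages_arrow [HasZeroObject C] (hC : HasNormalImages C) :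
    HasNormalImages (Arrow C) := by
  intro R B Z N π₁ π₂ δ h n hπ h₁ h₂ hn₁ hnh hN
  obtain ⟨Ql, ql, cl, kl⟩ := hC π₁.left π₂.left δ.left h.left n.left
    ⟨fun T f g a b => by
      obtain ⟨f, rfl⟩ := exists_hom_left R f
      obtain ⟨g, rfl⟩ := exists_hom_left R g
      exact congrArg CommaMorphism.left
        (hπ.right_cancellation f g (ext_left _ _ _ a) (ext_left _ _ _ b))⟩
    (congrArg CommaMorphism.left h₁) (congrArg CommaMorphism.left h₂)
    (congrArg CommaMorphism.left hn₁) (congrArg CommaMorphism.left hnh)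
    (fun T t a b => by
      obtain ⟨t, rfl⟩ := exists_hom_left R t
      obtain ⟨t', e, u⟩ := hN t (ext_left _ _ _ a) (ext_left _ _ _ b)
      refine ⟨t'.left, congrArg CommaMorphism.left e, fun y hy => ?_⟩
      obtain ⟨y, rfl⟩ := exists_hom_left N y
      exact congrArg CommaMorphism.left (u y (ext_left _ _ _ hy)))
  obtain ⟨Qr, qr, cr, kr⟩ := hC π₁.right π₂.right δ.right h.right n.right
    ⟨fun T f g a b => by
      obtain ⟨f, rfl⟩ := exists_hom_right R f
      obtain ⟨g, rfl⟩ := exists_hom_right R g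
      exact congrArg CommaMorphism.right
        (hπ.right_cancellation f g (ext_right _ _ _ a) (ext_right _ _ _ b))⟩
    (congrArg CommaMorphism.right h₁) (congrArg CommaMorphism.right h₂)
    (congrArg CommaMorphism.right hn₁) (congrArg CommaMorphism.right hnh)
    (fun T t a b => by
      obtain ⟨t, rfl⟩ := exists_hom_right R t
      obtain ⟨t', e, u⟩ := hN t (ext_right _ _ _ a) (ext_right _ _ _ b)
      refine ⟨t'.right, congrArg CommaMorphism.right e, fun y hy => ?_⟩
      obtain ⟨y, rfl⟩ := exists_hom_right N y
      exact congrArg CommaMorphism.right (u y (ext_right _ _ _ hy)))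
  have hw : (n.left ≫ π₂.left) ≫ B.hom = N.hom ≫ n.right ≫ π₂.right := Arrow.w (n ≫ π₂)
  obtain ⟨m, hm, -⟩ := cl.2 (B.hom ≫ qr) (by
    have := cr.1
    rw [← Category.assoc, hw, Category.assoc, this, comp_zero])
  refine ⟨Arrow.mk m, Arrow.homMk ql qr hm, ⟨Arrow.hom_ext _ _ cl.1 cr.1, fun T t ht => ?_⟩,
    isKer_arrow _ _ kl kr⟩
  obtain ⟨a, ha, ha'⟩ := cl.2 t.left (congrArg CommaMorphism.left ht)
  obtain ⟨b, hb, hb'⟩ := cr.2 t.right (congrArg CommaMorphism.right ht)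
  have hab : a ≫ T.hom = m ≫ b := by
    refine (cl.2 (t.left ≫ T.hom) ?_).unique ?_ ?_
    · have : (n.left ≫ π₂.left) ≫ t.left = 0 := congrArg CommaMorphism.left ht
      rw [← Category.assoc, this, zero_comp]
    · rw [reassoc_of% ha]
    · rw [reassoc_of% hm, hb, Arrow.w t]
  exact ⟨Arrow.homMk a b hab, Arrow.hom_ext _ _ ha hb, fun y hy => Arrow.hom_ext _ _
    (ha' _ (congrArg CommaMorphism.left hy)) (hb' _ (congrArg CommaMorphism.right hy))⟩

end ArrowZero

section Centralisation

variable {C : Type u} [Category.{v} C] [HasFiniteLimits C]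

/-- The functor that sends `f : B ⟶ A` to the first projection `π₁ : R[f] ⟶ B` of its kernel
pair. -/
noncomputable def kernelPairFst (C : Type u) [Category.{v} C] [HasFiniteLimits C] :
    Arrow C ⥤ Arrow C where
  obj f := Arrow.mk (pullback.fst f.hom f.hom)
  map {f g} φ := Arrow.homMk (pullback.lift (pullback.fst f.hom f.hom ≫ φ.left)
    (pullback.snd f.hom f.hom ≫ φ.left)
    (by rw [Category.assoc, Category.assoc, Arrow.w φ, pullback.condition_assoc])) φ.left
    (pullback.lift_fst _ _ _)
  map_id f := Arrow.hom_ext _ _ (pullback.hom_ext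
    ((pullback.lift_fst _ _ _).trans (by simp)) ((pullback.lift_snd _ _ _).trans (by simp))) rfl
  map_comp {f g h} φ ψ := Arrow.hom_ext _ _ (pullback.hom_ext
    ((pullback.lift_fst _ _ _).trans (by simp [pullback.lift_fst, pullback.lift_fst_assoc]))
    ((pullback.lift_snd _ _ _).trans (by simp [pullback.lift_snd, pullback.lift_snd_assoc]))) rfl

variable [HasZeroMorphisms C]

/-- The map `K[J π₁] ⟶ J R[f] ⟶ J B ⟶ B` given by the kernel of `J π₁`, by `J π₂` and by `μ`. -/
noncomputable def nextι {J : C ⥤ C} (μ : J ⟶ 𝟭 C) (f : Arrow C) :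
    kernel (J.map (pullback.fst f.hom f.hom)) ⟶ f.left :=
  kernel.ι (J.map (pullback.fst f.hom f.hom)) ≫ J.map (pullback.snd f.hom f.hom) ≫ μ.app f.left

theorem nextι_eq {J : C ⥤ C} (μ : J ⟶ 𝟭 C) (f : Arrow C) :
    nextι μ f = (kernel.ι (J.map (pullback.fst f.hom f.hom)) ≫ μ.app (pullback f.hom f.hom)) ≫
      pullback.snd f.hom f.hom := by
  have := μ.naturality (pullback.snd f.hom f.hom)
  rw [Functor.id_map] at this
  rw [nextι, this, Category.assoc]

theorem nextι_fst {J : C ⥤ C} (μ : J ⟶ 𝟭 C) (f : Arrow C) :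
    (kernel.ι (J.map (pullback.fst f.hom f.hom)) ≫ μ.app (pullback f.hom f.hom)) ≫
      pullback.fst f.hom f.hom = 0 := by
  have := μ.naturality (pullback.fst f.hom f.hom)
  rw [Functor.id_map] at this
  rw [Category.assoc]
  refine (congrArg (kernel.ι (J.map (pullback.fst f.hom f.hom)) ≫ ·) this.symm).trans ?_
  rw [← Category.assoc, kernel.condition, zero_comp]

theorem nextι_comp {J : C ⥤ C} (μ : J ⟶ 𝟭 C) (f : Arrow C) : nextι μ f ≫ f.hom = 0 := by
  rw [nextι_eq, Category.assoc, ← pullback.condition, ← Category.assoc, nextι_fst, zero_comp]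

/-- Every component of `μ` is a normal monomorphism, i.e. the kernel of some map. -/
def IsNormalTrans {J : C ⥤ C} (μ : J ⟶ 𝟭 C) : Prop :=
  ∀ X : C, ∃ (Z : C) (h : X ⟶ Z), IsKer (μ.app X) h

theorem exists_isCoker {J : C ⥤ C} {μ : J ⟶ 𝟭 C} (hC : HasNormalImages C) (hμ : IsNormalTrans μ)
    (f : Arrow C) : ∃ (Q : C) (q : f.left ⟶ Q), IsCoker (nextι μ f) q ∧ IsKer (nextι μ f) q := by
  obtain ⟨Z, h, hh⟩ := hμ (pullback f.hom f.hom)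
  rw [nextι_eq]
  refine hC (pullback.fst f.hom f.hom) _ (pullback.lift (𝟙 _) (𝟙 _) rfl) h _
    ⟨fun T a b h₁ h₂ => pullback.hom_ext h₁ h₂⟩ (pullback.lift_fst _ _ _)
    (pullback.lift_snd _ _ _) (nextι_fst μ f) ?_ ?_
  · rw [Category.assoc]
    exact (congrArg _ hh.1).trans comp_zero
  · intro T t ht₁ ht₂
    obtain ⟨a, ha, ha'⟩ := hh.2 t ht₂
    obtain ⟨Z', h', hh'⟩ := hμ f.left
    have hn := μ.naturality (pullback.fst f.hom f.hom)
    rw [Functor.id_map] at hn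
    have hz : a ≫ J.map (pullback.fst f.hom f.hom) = 0 := by
      refine (hh'.2 0 zero_comp).unique ?_ zero_comp
      rw [Category.assoc, hn]
      exact (Category.assoc _ _ _).symm.trans ((congrArg (· ≫ _) ha).trans ht₁)
    refine ⟨kernel.lift _ a hz, ?_, fun y hy => ?_⟩
    · exact (Category.assoc _ _ _).symm.trans ((congrArg (· ≫ _) (kernel.lift_ι _ _ _)).trans ha)
    · rw [← cancel_mono (kernel.ι (J.map (pullback.fst f.hom f.hom))), kernel.lift_ι]
      exact ha' _ ((Category.assoc _ _ _).trans hy)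

theorem hasCokernel_nextι {J : C ⥤ C} {μ : J ⟶ 𝟭 C} (hC : HasNormalImages C)
    (hμ : IsNormalTrans μ) (f : Arrow C) : HasCokernel (nextι μ f) := by
  obtain ⟨Q, q, hq, -⟩ := exists_isCoker hC hμ f
  choose d hd hd' using hq.2
  exact ⟨⟨⟨_, CokernelCofork.IsColimit.ofπ q hq.1 (fun g hg => d g hg)
    (fun g hg => hd g hg) (fun g hg m hm => hd' g hg m hm)⟩⟩⟩

variable [HasZeroObject C]

/-- The functor that sends `f : B ⟶ A` to `K[J π₁] ⟶ 0`, where `(π₁, π₂)` is the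
kernel pair of `f`. -/
noncomputable def nextJ (J : C ⥤ C) : Arrow C ⥤ Arrow C :=
  kernelPairFst C ⋙ J.mapArrow ⋙ ker C ⋙ toZero C

theorem nextι_naturality {J : C ⥤ C} (μ : J ⟶ 𝟭 C) {f g : Arrow C} (φ : f ⟶ g) :
    ((nextJ J).map φ).left ≫ nextι μ g = nextι μ f ≫ φ.left := by
  have h₁ : ((nextJ J).map φ).left ≫ kernel.ι (J.map (pullback.fst g.hom g.hom)) =
      kernel.ι (J.map (pullback.fst f.hom f.hom)) ≫ J.map ((kernelPairFst C).map φ).left :=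
    kernel.lift_ι _ _ _
  have h₂ : ((kernelPairFst C).map φ).left ≫ pullback.snd g.hom g.hom =
      pullback.snd f.hom f.hom ≫ φ.left := pullback.lift_snd _ _ _
  have h₃ := μ.naturality φ.left
  rw [Functor.id_map] at h₃
  have h₄ : J.map ((kernelPairFst C).map φ).left ≫ J.map (pullback.snd g.hom g.hom) =
      J.map (pullback.snd f.hom f.hom) ≫ J.map φ.left :=
    (J.map_comp _ _).symm.trans ((congrArg J.map h₂).trans (J.map_comp _ _))
  have h₅ : J.map ((kernelPairFst C).map φ).left ≫ J.map (pullback.snd g.hom g.hom) ≫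
      μ.app g.left = J.map (pullback.snd f.hom f.hom) ≫ μ.app f.left ≫ φ.left :=
    (Category.assoc _ _ _).symm.trans ((congrArg (· ≫ μ.app g.left) h₄).trans
      ((Category.assoc _ _ _).trans (congrArg (J.map (pullback.snd f.hom f.hom) ≫ ·) h₃)))
  have h₆ : nextι μ f ≫ φ.left = kernel.ι (J.map (pullback.fst f.hom f.hom)) ≫
      J.map (pullback.snd f.hom f.hom) ≫ μ.app f.left ≫ φ.left :=
    (Category.assoc _ _ _).trans
      (congrArg (kernel.ι (J.map (pullback.fst f.hom f.hom)) ≫ ·) (Category.assoc _ _ _))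
  exact (Category.assoc _ _ _).symm.trans ((congrArg
    (· ≫ J.map (pullback.snd g.hom g.hom) ≫ μ.app g.left) h₁).trans ((Category.assoc _ _ _).trans
    ((congrArg (kernel.ι (J.map (pullback.fst f.hom f.hom)) ≫ ·) h₅).trans h₆.symm)))

/-- The natural transformation with components `nextJ J f ⟶ f`. -/
noncomputable def nextμ {J : C ⥤ C} (μ : J ⟶ 𝟭 C) : nextJ J ⟶ 𝟭 (Arrow C) where
  app f := Arrow.homMk (nextι μ f) 0 ((nextι_comp μ f).trans comp_zero.symm)
  naturality _ _ φ := Arrow.hom_ext _ _ (nextι_naturality μ φ)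
    ((isZero_zero C).eq_of_src _ _)

theorem isNormalTrans_nextμ {J : C ⥤ C} {μ : J ⟶ 𝟭 C} (hC : HasNormalImages C)
    (hμ : IsNormalTrans μ) : IsNormalTrans (nextμ μ) := by
  intro f
  obtain ⟨Q, q, hq, hk⟩ := exists_isCoker hC hμ f
  obtain ⟨m, hm, -⟩ := hq.2 f.hom (nextι_comp μ f)
  refine ⟨Arrow.mk m, Arrow.homMk q (𝟙 _) (hm.trans (Category.comp_id _).symm),
    isKer_arrow _ _ hk ⟨zero_comp, fun T t ht => ⟨0, ?_, fun y _ => (isZero_zero C).eq_of_tgt _ _⟩⟩⟩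
  exact comp_zero.trans (ht.symm.trans (Category.comp_id t))

/-- The functor that sends `f : B ⟶ A` to the induced map `B / K[J π₁] ⟶ A`. -/
noncomputable def nextI {J : C ⥤ C} (μ : J ⟶ 𝟭 C) (hμ : ∀ f, HasCokernel (nextι μ f)) :
    Arrow C ⥤ Arrow C where
  obj f := Arrow.mk (cokernel.desc (nextι μ f) f.hom (nextι_comp μ f))
  map {f g} φ := Arrow.homMk
    (cokernel.map (nextι μ f) (nextι μ g) ((nextJ J).map φ).left φ.left
      (nextι_naturality μ φ).symm) φ.right (by
        apply coequalizer.hom_ext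
        simp)
  map_id f := Arrow.hom_ext _ _ (coequalizer.hom_ext (by simp)) rfl
  map_comp φ ψ := Arrow.hom_ext _ _ (coequalizer.hom_ext (by simp)) rfl

end Centralisation

section Extensions

variable {C : Type u} [Category.{v} C]

/-- Given a class `W` of morphisms, the class of all squares `φ : f ⟶ g` such that `f`, `g`, both
components of `φ`, and the comparison map to the pullback of `g` and the component of `φ` between
the codomains belong to `W`. -/
def doubleExt [HasPullbacks C] (W : MorphismProperty C) : MorphismProperty (Arrow C) :=
  fun f g φ => W f.hom ∧ W g.hom ∧ W φ.left ∧ W φ.right ∧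
    W (pullback.lift (f := g.hom) (g := φ.right) φ.left f.hom (Arrow.w φ))

/-- Closure properties shared by the class `P` of `k`-extensions and
the class `W` of `(k+1)`-extensions. -/
structure StablePair (P : ObjectProperty C) (W : MorphismProperty C) : Prop where
  iso {X Y : C} (e : X ≅ Y) : P X → P Y
  src {X Y : C} (f : X ⟶ Y) : W f → P X
  tgt {X Y : C} (f : X ⟶ Y) : W f → P Y
  comp {X Y Z : C} (f : X ⟶ Y) (g : Y ⟶ Z) : W f → W g → W (f ≫ g)
  baseChange {Q X Y Z : C} {a : Q ⟶ X} {b : Q ⟶ Y} {f : X ⟶ Z} {g : Y ⟶ Z} :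
    IsPullback a b f g → W f → P Y → W b

namespace StablePair

variable {P : ObjectProperty C} {W : MorphismProperty C}

theorem iso_comp (h : StablePair P W) {X Y Z : C} (i : X ⟶ Y) [IsIso i] (f : Y ⟶ Z) (hf : W f) :
    W (i ≫ f) :=
  h.baseChange (a := i) (g := 𝟙 Z) (IsPullback.of_horiz_isIso ⟨by simp⟩) hf (h.tgt f hf)

theorem comp_iso (h : StablePair P W) {X Y Z : C} (f : X ⟶ Y) (i : Y ⟶ Z) [IsIso i] (hf : W f) :
    W (f ≫ i) :=
  h.baseChange (a := 𝟙 X) (g := inv i) (IsPullback.of_horiz_isIso ⟨by simp⟩) hf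
    (h.iso (asIso i) (h.tgt f hf))

theorem of_iso_comp (h : StablePair P W) {X Y Z : C} (i : X ⟶ Y) [IsIso i] (f : Y ⟶ Z)
    (hf : W (i ≫ f)) : W f := by
  simpa using h.iso_comp (inv i) _ hf

end StablePair

theorem isPullback_iff {Q X Y Z : C} {a : Q ⟶ X} {b : Q ⟶ Y} {f : X ⟶ Z} {g : Y ⟶ Z} :
    IsPullback a b f g ↔ a ≫ f = b ≫ g ∧ ∀ ⦃T : C⦄ (s : T ⟶ X) (t : T ⟶ Y), s ≫ f = t ≫ g →
      ∃! r : T ⟶ Q, r ≫ a = s ∧ r ≫ b = t := by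
  constructor
  · intro h
    exact ⟨h.w, fun T s t e => ⟨h.lift s t e, ⟨h.lift_fst _ _ _, h.lift_snd _ _ _⟩,
      fun y hy => h.hom_ext (hy.1.trans (h.lift_fst _ _ _).symm)
        (hy.2.trans (h.lift_snd _ _ _).symm)⟩⟩
  · rintro ⟨w, h⟩
    choose l hl hl' using h
    exact ⟨⟨w⟩, ⟨PullbackCone.IsLimit.mk w (fun s => l s.fst s.snd s.condition)
      (fun s => (hl s.fst s.snd s.condition).1) (fun s => (hl s.fst s.snd s.condition).2)
      (fun s m h₁ h₂ => hl' s.fst s.snd s.condition m ⟨h₁, h₂⟩)⟩⟩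

theorem isPullback_left {Q X Y Z : Arrow C} {a : Q ⟶ X} {b : Q ⟶ Y} {f : X ⟶ Z} {g : Y ⟶ Z}
    (h : IsPullback a b f g) : IsPullback a.left b.left f.left g.left := by
  rw [isPullback_iff] at h ⊢
  refine ⟨congrArg CommaMorphism.left h.1, fun T s t e => ?_⟩
  obtain ⟨s, rfl⟩ := exists_hom_left X s
  obtain ⟨t, rfl⟩ := exists_hom_left Y t
  obtain ⟨r, hr, hr'⟩ := h.2 s t (ext_left _ _ _ e)
  refine ⟨r.left, ⟨congrArg CommaMorphism.left hr.1, congrArg CommaMorphism.left hr.2⟩, ?_⟩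
  intro y hy
  obtain ⟨y, rfl⟩ := exists_hom_left Q y
  exact congrArg CommaMorphism.left (hr' y ⟨ext_left _ _ _ hy.1, ext_left _ _ _ hy.2⟩)

theorem isPullback_right [HasZeroMorphisms C] [HasZeroObject C] {Q X Y Z : Arrow C} {a : Q ⟶ X}
    {b : Q ⟶ Y} {f : X ⟶ Z} {g : Y ⟶ Z} (h : IsPullback a b f g) :
    IsPullback a.right b.right f.right g.right := by
  rw [isPullback_iff] at h ⊢
  refine ⟨congrArg CommaMorphism.right h.1, fun T s t e => ?_⟩
  obtain ⟨s, rfl⟩ := exists_hom_right X s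
  obtain ⟨t, rfl⟩ := exists_hom_right Y t
  obtain ⟨r, hr, hr'⟩ := h.2 s t (ext_right _ _ _ e)
  refine ⟨r.right, ⟨congrArg CommaMorphism.right hr.1, congrArg CommaMorphism.right hr.2⟩, ?_⟩
  intro y hy
  obtain ⟨y, rfl⟩ := exists_hom_right Q y
  exact congrArg CommaMorphism.right (hr' y ⟨ext_right _ _ _ hy.1, ext_right _ _ _ hy.2⟩)

theorem stablePair_doubleExt [HasFiniteLimits C] [HasZeroMorphisms C] [HasZeroObject C]
    {P : ObjectProperty C} {W : MorphismProperty C} (h : StablePair P W) :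
    StablePair (fun f : Arrow C => W f.hom) (doubleExt W) where
  iso {f g} e hf := by
    rw [Arrow.iso_w e]
    exact h.iso_comp _ _ (h.comp_iso _ _ hf)
  src _ hφ := hφ.1
  tgt _ hφ := hφ.2.1
  comp {c d e} φ ψ hφ hψ := by
    refine ⟨hφ.1, hψ.2.1, h.comp _ _ hφ.2.2.1 hψ.2.2.1, h.comp _ _ hφ.2.2.2.1 hψ.2.2.2.1, ?_⟩
    let l : d.left ⟶ pullback e.hom ψ.right := pullback.lift ψ.left d.hom (Arrow.w ψ)
    let l₀ : c.left ⟶ pullback d.hom φ.right := pullback.lift φ.left c.hom (Arrow.w φ)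
    let j : pullback e.hom (φ.right ≫ ψ.right) ⟶ pullback e.hom ψ.right :=
      pullback.lift (pullback.fst _ _) (pullback.snd _ _ ≫ φ.right)
        (by rw [pullback.condition, Category.assoc])
    let k : pullback d.hom φ.right ⟶ pullback e.hom (φ.right ≫ ψ.right) :=
      pullback.lift (pullback.fst _ _ ≫ ψ.left) (pullback.snd _ _)
        (by rw [Category.assoc, Arrow.w ψ, pullback.condition_assoc])
    have hl : l ≫ pullback.fst _ _ = ψ.left := pullback.lift_fst _ _ _
    have hl' : l ≫ pullback.snd _ _ = d.hom := pullback.lift_snd _ _ _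
    have hj : j ≫ pullback.fst _ _ = pullback.fst _ _ := pullback.lift_fst _ _ _
    have hj' : j ≫ pullback.snd _ _ = pullback.snd _ _ ≫ φ.right := pullback.lift_snd _ _ _
    have hk : k ≫ pullback.fst _ _ = pullback.fst _ _ ≫ ψ.left := pullback.lift_fst _ _ _
    have hk' : k ≫ pullback.snd _ _ = pullback.snd _ _ := pullback.lift_snd _ _ _
    have h₁ : IsPullback (pullback.fst d.hom φ.right) k l j := by
      rw [isPullback_iff]
      refine ⟨pullback.hom_ext ?_ ?_, fun T s t e => ?_⟩
      · rw [Category.assoc, hl, Category.assoc, hj, hk]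
      · rw [Category.assoc, hl', Category.assoc, hj', reassoc_of% hk', pullback.condition]
      · have e₁ := e =≫ pullback.fst _ _
        have e₂ := e =≫ pullback.snd _ _
        rw [Category.assoc, Category.assoc, hl, hj] at e₁
        rw [Category.assoc, Category.assoc, hl', hj', ← Category.assoc] at e₂
        refine ⟨pullback.lift s (t ≫ pullback.snd _ _) e₂, ⟨pullback.lift_fst _ _ _,
          pullback.hom_ext ?_ ?_⟩, fun y hy => pullback.hom_ext ?_ ?_⟩
        · rw [Category.assoc, hk, pullback.lift_fst_assoc, e₁]
        · rw [Category.assoc, hk', pullback.lift_snd]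
        · rw [hy.1, pullback.lift_fst]
        · rw [pullback.lift_snd, ← hy.2, Category.assoc, hk']
    have hP : P (pullback e.hom (φ.right ≫ ψ.right)) :=
      h.src _ (h.baseChange (IsPullback.of_hasPullback e.hom (φ.right ≫ ψ.right)) hψ.2.1
        (h.src _ hφ.2.2.2.1))
    have hWk : W k := h.baseChange h₁ hψ.2.2.2.2 hP
    have hw : (φ.left ≫ ψ.left) ≫ e.hom = c.hom ≫ φ.right ≫ ψ.right := Arrow.w (φ ≫ ψ)
    have key : l₀ ≫ k = pullback.lift (φ.left ≫ ψ.left) c.hom hw := by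
      apply pullback.hom_ext
      · rw [pullback.lift_fst, Category.assoc, hk, pullback.lift_fst_assoc]
      · rw [pullback.lift_snd, Category.assoc, hk', pullback.lift_snd]
    have := h.comp l₀ k hφ.2.2.2.2 hWk
    rw [key] at this
    exact this
  baseChange {Q X Y Z a b f g} hp hf hY := by
    have pl := isPullback_left hp
    have pr := isPullback_right hp
    have hbl : W b.left := h.baseChange pl hf.2.2.1 (h.src _ hY)
    have hbr : W b.right := h.baseChange pr hf.2.2.2.1 (h.tgt _ hY)
    let κ : Q.left ⟶ pullback Y.hom b.right := pullback.lift b.left Q.hom (Arrow.w b)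
    let γ : X.left ⟶ pullback Z.hom f.right := pullback.lift f.left X.hom (Arrow.w f)
    let j : pullback Y.hom b.right ⟶ pullback Z.hom f.right :=
      pullback.lift (pullback.fst _ _ ≫ g.left) (pullback.snd _ _ ≫ a.right) (by
        rw [Category.assoc, Arrow.w g, pullback.condition_assoc, Category.assoc, pr.w])
    have hκ : κ ≫ pullback.fst _ _ = b.left := pullback.lift_fst _ _ _
    have hκ' : κ ≫ pullback.snd _ _ = Q.hom := pullback.lift_snd _ _ _
    have hγ : γ ≫ pullback.fst _ _ = f.left := pullback.lift_fst _ _ _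
    have hγ' : γ ≫ pullback.snd _ _ = X.hom := pullback.lift_snd _ _ _
    have hj : j ≫ pullback.fst _ _ = pullback.fst _ _ ≫ g.left := pullback.lift_fst _ _ _
    have hj' : j ≫ pullback.snd _ _ = pullback.snd _ _ ≫ a.right := pullback.lift_snd _ _ _
    have h₁ : IsPullback a.left κ γ j := by
      rw [isPullback_iff]
      refine ⟨pullback.hom_ext ?_ ?_, fun T s t e => ?_⟩
      · rw [Category.assoc, hγ, Category.assoc, hj, reassoc_of% hκ, pl.w]
      · rw [Category.assoc, hγ', Category.assoc, hj', reassoc_of% hκ', Arrow.w a]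
      · have e₁ := e =≫ pullback.fst _ _
        have e₂ := e =≫ pullback.snd _ _
        rw [Category.assoc, Category.assoc, hγ, hj, ← Category.assoc] at e₁
        rw [Category.assoc, Category.assoc, hγ', hj'] at e₂
        refine ⟨pl.lift s (t ≫ pullback.fst _ _) e₁, ⟨pl.lift_fst _ _ _,
          pullback.hom_ext ?_ (pr.hom_ext ?_ ?_)⟩, fun y hy => pl.hom_ext ?_ ?_⟩
        · rw [Category.assoc, hκ, pl.lift_snd]
        · simp only [Category.assoc]
          rw [reassoc_of% hκ', ← Arrow.w a, pl.lift_fst_assoc, e₂]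
        · simp only [Category.assoc]
          rw [reassoc_of% hκ', ← Arrow.w b, pl.lift_snd_assoc, Category.assoc,
            pullback.condition]
        · rw [hy.1, pl.lift_fst]
        · rw [pl.lift_snd, ← hy.2, Category.assoc, hκ]
    have hM : P (pullback Y.hom b.right) :=
      h.src _ (h.baseChange (IsPullback.of_hasPullback Y.hom b.right).flip hbr (h.src _ hY))
    have hWκ : W κ := h.baseChange h₁ hf.2.2.2.2 hM
    refine ⟨?_, hY, hbl, hbr, hWκ⟩
    rw [← hκ']
    exact h.comp _ _ hWκ (h.baseChange (IsPullback.of_hasPullback Y.hom b.right) hY (h.src _ hbr))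

/-- Kernels of morphisms in `W` belong to `P`. -/
def KernelsIn [HasZeroMorphisms C] (P : ObjectProperty C) (W : MorphismProperty C) : Prop :=
  ∀ ⦃N X Y : C⦄ (n : N ⟶ X) (f : X ⟶ Y), IsKer n f → W f → P N

theorem kernelsIn_doubleExt [HasFiniteLimits C] [HasZeroMorphisms C] [HasZeroObject C]
    {P : ObjectProperty C} {W : MorphismProperty C} (h : StablePair P W) (hk : KernelsIn P W) :
    KernelsIn (fun f : Arrow C => W f.hom) (doubleExt W) := by
  intro N f g n φ hn hφ
  have hl : IsKer n.left φ.left := by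
    refine ⟨congrArg CommaMorphism.left hn.1, fun T t ht => ?_⟩
    obtain ⟨t, rfl⟩ := exists_hom_left f t
    obtain ⟨r, hr, hr'⟩ := hn.2 t (ext_left _ _ _ ht)
    refine ⟨r.left, congrArg CommaMorphism.left hr, fun y hy => ?_⟩
    obtain ⟨y, rfl⟩ := exists_hom_left N y
    exact congrArg CommaMorphism.left (hr' y (ext_left _ _ _ hy))
  have hr : IsKer n.right φ.right := by
    refine ⟨congrArg CommaMorphism.right hn.1, fun T t ht => ?_⟩
    obtain ⟨t, rfl⟩ := exists_hom_right f t
    obtain ⟨r, hr, hr'⟩ := hn.2 t (ext_right _ _ _ ht)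
    refine ⟨r.right, congrArg CommaMorphism.right hr, fun y hy => ?_⟩
    obtain ⟨y, rfl⟩ := exists_hom_right N y
    exact congrArg CommaMorphism.right (hr' y (ext_right _ _ _ hy))
  let κ : f.left ⟶ pullback g.hom φ.right := pullback.lift φ.left f.hom (Arrow.w φ)
  let j : N.right ⟶ pullback g.hom φ.right := pullback.lift 0 n.right
    (by rw [zero_comp, hr.1])
  have hκ : κ ≫ pullback.fst _ _ = φ.left := pullback.lift_fst _ _ _
  have hκ' : κ ≫ pullback.snd _ _ = f.hom := pullback.lift_snd _ _ _
  have hj : j ≫ pullback.fst _ _ = 0 := pullback.lift_fst _ _ _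
  have hj' : j ≫ pullback.snd _ _ = n.right := pullback.lift_snd _ _ _
  refine h.baseChange (a := n.left) (f := κ) (g := j) ?_ hφ.2.2.2.2 (hk _ _ hr hφ.2.2.2.1)
  rw [isPullback_iff]
  refine ⟨pullback.hom_ext ?_ ?_, fun T s t e => ?_⟩
  · rw [Category.assoc, hκ, Category.assoc, hj, comp_zero, hl.1]
  · rw [Category.assoc, hκ', Category.assoc, hj', Arrow.w n]
  · have e₁ := e =≫ pullback.fst _ _
    have e₂ := e =≫ pullback.snd _ _
    rw [Category.assoc, Category.assoc, hκ, hj, comp_zero] at e₁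
    rw [Category.assoc, Category.assoc, hκ', hj'] at e₂
    obtain ⟨r, hr₁, hr₂⟩ := hl.2 s e₁
    refine ⟨r, ⟨hr₁, ?_⟩, fun y hy => hr₂ y hy.1⟩
    refine (hr.2 (t ≫ n.right) (by rw [Category.assoc, hr.1, comp_zero])).unique ?_ rfl
    rw [Category.assoc, ← Arrow.w n, reassoc_of% hr₁, e₂]

/-- The class of maps of arrows that are isomorphisms between the codomains and
belong to `T` between the domains. -/
def nextQuot (T : MorphismProperty C) : MorphismProperty (Arrow C) :=
  fun _ _ φ => IsIso φ.right ∧ T φ.left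

/-- If a composite `t ≫ g` with `t` in `T` belongs to `W`, then so does `g`. -/
def QuotStable (T W : MorphismProperty C) : Prop :=
  ∀ ⦃X Y Z : C⦄ (t : X ⟶ Y) (g : Y ⟶ Z), T t → W (t ≫ g) → W g

theorem quotStable_doubleExt [HasFiniteLimits C] {P : ObjectProperty C}
    {T W : MorphismProperty C} (h : StablePair P W) (hT : QuotStable T W) :
    QuotStable (nextQuot T) (doubleExt W) := by
  rintro f f' g φ ψ ⟨hi, hφ⟩ ⟨h₁, h₂, h₃, h₄, h₅⟩
  have hw : (φ.left ≫ ψ.left) ≫ g.hom = f.hom ≫ φ.right ≫ ψ.right := Arrow.w (φ ≫ ψ)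
  refine ⟨hT φ.left _ hφ ?_, h₂, hT φ.left _ hφ h₃, h.of_iso_comp φ.right _ h₄,
    hT φ.left _ hφ ?_⟩
  · rw [Arrow.w φ]
    exact h.comp_iso _ _ h₁
  · let i : pullback g.hom (φ.right ≫ ψ.right) ⟶ pullback g.hom ψ.right :=
      pullback.lift (pullback.fst _ _) (pullback.snd _ _ ≫ φ.right)
        (by rw [pullback.condition, Category.assoc])
    have hii : IsIso i := by
      refine ⟨pullback.lift (pullback.fst _ _) (pullback.snd _ _ ≫ inv φ.right)
        (by simp [pullback.condition]), pullback.hom_ext ?_ ?_, pullback.hom_ext ?_ ?_⟩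
      · simp [i, pullback.lift_fst]
      · simp [i, pullback.lift_snd, pullback.lift_snd_assoc]
      · simp [i, pullback.lift_fst]
      · simp [i, pullback.lift_snd, pullback.lift_snd_assoc]
    have h₆ : W (pullback.lift (f := g.hom) (g := φ.right ≫ ψ.right) (φ.left ≫ ψ.left) f.hom hw) :=
      h₅
    have key : φ.left ≫ pullback.lift ψ.left f'.hom (Arrow.w ψ) =
        pullback.lift (φ.left ≫ ψ.left) f.hom hw ≫ i := by
      apply pullback.hom_ext
      · simp [i, pullback.lift_fst]
      · simp [i, pullback.lift_snd, pullback.lift_snd_assoc]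
    rw [key]
    exact h.comp_iso _ _ h₆

/-- The cokernel of a map whose domain satisfies `S` belongs to `T`. -/
def CokernelsIn [HasZeroMorphisms C] (S : ObjectProperty C) (T : MorphismProperty C) : Prop :=
  ∀ ⦃X Y Q : C⦄ (j : X ⟶ Y) (q : Y ⟶ Q), IsCoker j q → S X → T q

/-- The class of arrows with codomain zero and with domain in `S`. -/
def nextSparse (S : ObjectProperty C) : ObjectProperty (Arrow C) :=
  fun f => IsZero f.right ∧ S f.left

theorem cokernelsIn_nextQuot [HasZeroMorphisms C] [HasZeroObject C] {S : ObjectProperty C}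
    {T : MorphismProperty C} (h : CokernelsIn S T) : CokernelsIn (nextSparse S) (nextQuot T) := by
  rintro x b Q j q hq ⟨hx, hS⟩
  refine ⟨?_, h j.left q.left ⟨congrArg CommaMorphism.left hq.1, fun Z t ht => ?_⟩ hS⟩
  · have hj : j.right = 0 := hx.eq_of_src _ _
    let u : b ⟶ Arrow.mk (𝟙 b.right) := Arrow.homMk b.hom (𝟙 _) (by simp)
    obtain ⟨d, hd, -⟩ := hq.2 u (Arrow.hom_ext _ _ (by
      change j.left ≫ b.hom = 0
      rw [Arrow.w j, hj, comp_zero]) (by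
      change j.right ≫ 𝟙 _ = 0
      rw [hj, zero_comp]))
    have e : q.right ≫ d.right = 𝟙 _ := congrArg CommaMorphism.right hd
    refine ⟨d.right, e, ?_⟩
    let v : Q ⟶ Arrow.mk (𝟙 Q.right) := Arrow.homMk Q.hom (𝟙 _) (by simp)
    let v' : Q ⟶ Arrow.mk (𝟙 Q.right) := Arrow.homMk (Q.hom ≫ d.right ≫ q.right)
      (d.right ≫ q.right) (by simp)
    have huv : v' = v := by
      refine (hq.2 (q ≫ v) (by rw [← Category.assoc, hq.1, zero_comp])).unique ?_ rfl
      refine Arrow.hom_ext _ _ ?_ ?_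
      · change q.left ≫ Q.hom ≫ d.right ≫ q.right = q.left ≫ Q.hom
        have := Arrow.w q
        rw [reassoc_of% this, reassoc_of% e, this]
      · change q.right ≫ d.right ≫ q.right = q.right ≫ 𝟙 _
        rw [reassoc_of% e, Category.comp_id]
    exact congrArg CommaMorphism.right huv
  · let u : b ⟶ Arrow.mk (0 : Z ⟶ (0 : C)) := Arrow.homMk t 0 (by simp)
    obtain ⟨d, hd, hd'⟩ := hq.2 u
      (Arrow.hom_ext _ _ ht ((isZero_zero C).eq_of_tgt _ _))
    refine ⟨d.left, congrArg CommaMorphism.left hd, fun y hy => ?_⟩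
    let y' : Q ⟶ Arrow.mk (0 : Z ⟶ (0 : C)) := Arrow.homMk y 0 (by simp)
    exact congrArg CommaMorphism.left
      (hd' y' (Arrow.hom_ext _ _ hy ((isZero_zero C).eq_of_tgt _ _)))

/-- `S` is closed under subobjects. -/
def SubobjectsIn (S : ObjectProperty C) : Prop :=
  ∀ ⦃X Y : C⦄ (m : X ⟶ Y), Mono m → S Y → S X

theorem subobjectsIn_nextSparse [HasZeroMorphisms C] [HasZeroObject C] {S : ObjectProperty C}
    (h : SubobjectsIn S) : SubobjectsIn (nextSparse S) := by
  rintro x y m hm ⟨hy, hS⟩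
  refine ⟨?_, h m.left ⟨fun {Z} s t e => ?_⟩ hS⟩
  · rw [IsZero.iff_id_eq_zero]
    obtain ⟨s, hs⟩ := exists_hom_right x (𝟙 x.right)
    obtain ⟨t, ht⟩ := exists_hom_right x (0 : x.right ⟶ x.right)
    rw [← hs, ← ht]
    exact congrArg CommaMorphism.right ((cancel_mono m).1 (ext_right y _ _ (hy.eq_of_tgt _ _)))
  · obtain ⟨s, rfl⟩ := exists_hom_left x s
    obtain ⟨t, rfl⟩ := exists_hom_left x t
    exact congrArg CommaMorphism.left ((cancel_mono m).1 (ext_left y _ _ e))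

theorem nextSparse_nextJ [HasFiniteLimits C] [HasZeroMorphisms C] [HasZeroObject C]
    {S : ObjectProperty C} (h : SubobjectsIn S) {J : C ⥤ C} (hJ : ∀ X, S (J.obj X))
    (f : Arrow C) : nextSparse S ((nextJ J).obj f) := by
  have hm : Mono (kernel.ι (J.map (pullback.fst f.hom f.hom))) := inferInstance
  exact ⟨isZero_zero C, h _ hm (hJ _)⟩

theorem mem_nextI [HasFiniteLimits C] [HasZeroMorphisms C] [HasZeroObject C]
    {S : ObjectProperty C} {T W : MorphismProperty C} (hS : SubobjectsIn S)
    (hc : CokernelsIn S T) (hT : QuotStable T W) {J : C ⥤ C} (hJ : ∀ X, S (J.obj X))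
    (μ : J ⟶ 𝟭 C) (hμ : ∀ f, HasCokernel (nextι μ f)) (f : Arrow C) (hf : W f.hom) :
    W ((nextI μ hμ).obj f).hom := by
  refine hT (cokernel.π (nextι μ f)) _ (hc (nextι μ f) _ ⟨cokernel.condition _, fun Z t ht =>
    ⟨cokernel.desc _ t ht, cokernel.π_desc _ _ _, fun y hy => ?_⟩⟩ (nextSparse_nextJ hS hJ f).2) ?_
  · apply coequalizer.hom_ext
    exact hy.trans (cokernel.π_desc _ _ _).symm
  · have : cokernel.π (nextι μ f) ≫ ((nextI μ hμ).obj f).hom = f.hom := cokernel.π_desc _ _ _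
    rwa [this]

theorem stablePair_regularEpi [Regular C] :
    StablePair (⊤ : ObjectProperty C) (MorphismProperty.regularEpi C) where
  iso _ _ := trivial
  src _ _ := trivial
  tgt _ _ := trivial
  comp f g hf hg := by
    rw [MorphismProperty.regularEpi_iff] at hf hg ⊢
    infer_instance
  baseChange h hf _ := Regular.regularEpiIsStableUnderBaseChange.of_isPullback h.flip.flip hf

theorem quotStable_regularEpi [Regular C] :
    QuotStable (MorphismProperty.regularEpi C) (MorphismProperty.regularEpi C) := by
  intro X Y Z t g _ h
  rw [MorphismProperty.regularEpi_iff] at h ⊢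
  have := strongEpi_of_strongEpi t g
  infer_instance

theorem cokernelsIn_regularEpi [HasZeroMorphisms C] :
    CokernelsIn (⊤ : ObjectProperty C) (MorphismProperty.regularEpi C) := by
  intro X Y Q j q hq _
  choose d hd hd' using hq.2
  have : IsColimit (CokernelCofork.ofπ q hq.1) :=
    CokernelCofork.IsColimit.ofπ q hq.1 (fun g hg => d g hg)
      (fun g hg => hd g hg) (fun g hg m hm => hd' g hg m hm)
  exact ⟨⟨Cofork.IsColimit.regularEpi this⟩⟩

end Extensions

section Tower

variable (A : Type (max u v)) [Category.{v} A]

/-- The category of `k`-dimensional arrows in `A`: it is `A` for `k = 0`, and the category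
of arrows in the category of `k`-dimensional arrows for `k + 1`. -/
def arrCat : ℕ → Cat.{v, max u v}
  | 0 => Cat.of A
  | k + 1 => Cat.of (Arrow (arrCat k))

/-- The type of `k`-dimensional arrows in `A`. -/
abbrev Arr (k : ℕ) : Type (max u v) := arrCat.{v, u} A k

instance arrHasFiniteLimits [HasFiniteLimits A] : ∀ k, HasFiniteLimits (Arr.{v, u} A k)
  | 0 => inferInstanceAs (HasFiniteLimits A)
  | k + 1 =>
    have := arrHasFiniteLimits k
    inferInstanceAs (HasFiniteLimits (Arrow (Arr.{v, u} A k)))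

instance arrHasZeroMorphisms [HasZeroMorphisms A] : ∀ k, HasZeroMorphisms (Arr.{v, u} A k)
  | 0 => inferInstanceAs (HasZeroMorphisms A)
  | k + 1 =>
    have := arrHasZeroMorphisms k
    inferInstanceAs (HasZeroMorphisms (Arrow (Arr.{v, u} A k)))

instance arrHasZeroObject [HasZeroMorphisms A] [HasZeroObject A] :
    ∀ k, HasZeroObject (Arr.{v, u} A k)
  | 0 => inferInstanceAs (HasZeroObject A)
  | k + 1 =>
    have := arrHasZeroObject k
    inferInstanceAs (HasZeroObject (Arrow (Arr.{v, u} A k)))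

/-- The class of `(k+1)`-extensions, as a class of morphisms between `k`-dimensional arrows:
the regular epimorphisms of `A` for `k = 0`, and otherwise all squares in which the four
sides and the comparison map to the pullback are `k`-extensions. -/
def extMor [HasFiniteLimits A] : ∀ k, MorphismProperty (Arr.{v, u} A k)
  | 0 => MorphismProperty.regularEpi A
  | k + 1 => doubleExt (C := Arr.{v, u} A k) (extMor k)

/-- The `k`-extensions: all objects of `A` for `k = 0`, and the `(k+1)`-dimensional arrows which,
as morphisms of `k`-dimensional arrows, are `(k+1)`-extensions. -/
def isExt [HasFiniteLimits A] : ∀ k, ObjectProperty (Arr.{v, u} A k)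
  | 0 => ⊤
  | k + 1 => fun f : Arrow (Arr.{v, u} A k) => extMor A k f.hom

/-- The category `Ext^k A` of `k`-extensions in `A`, a full subcategory of `Arr^k A`. -/
abbrev Ext [HasFiniteLimits A] (k : ℕ) : Type (max u v) := (isExt.{v, u} A k).FullSubcategory

theorem stablePair_isExt [Regular A] [HasZeroMorphisms A] [HasZeroObject A] :
    ∀ k, StablePair (isExt.{v, u} A k) (extMor.{v, u} A k)
  | 0 => stablePair_regularEpi (C := A)
  | k + 1 => stablePair_doubleExt (C := Arr.{v, u} A k) (stablePair_isExt k)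

theorem kernelsIn_isExt [Regular A] [HasZeroMorphisms A] [HasZeroObject A] :
    ∀ k, KernelsIn (C := Arr.{v, u} A k) (isExt.{v, u} A k) (extMor.{v, u} A k)
  | 0 => fun _ _ _ _ _ _ _ => trivial
  | k + 1 => kernelsIn_doubleExt (C := Arr.{v, u} A k) (stablePair_isExt A k) (kernelsIn_isExt k)

/-- The codomain functor `Ext^{k+1} A ⥤ Ext^k A`. -/
def cod [Regular A] [HasZeroMorphisms A] [HasZeroObject A] (k : ℕ) :
    Ext.{v, u} A (k + 1) ⥤ Ext.{v, u} A k :=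
  (isExt.{v, u} A k).lift
    ((isExt.{v, u} A (k + 1)).ι ⋙ (Arrow.rightFunc : Arrow (Arr.{v, u} A k) ⥤ _))
    (fun f => (stablePair_isExt A k).tgt _ f.property)

/-- The kernel functor `Ext^{k+1} A ⥤ Ext^k A`, `f ↦ K[f]`. -/
noncomputable def kerExt [Regular A] [HasZeroMorphisms A] [HasZeroObject A] (k : ℕ) :
    Ext.{v, u} A (k + 1) ⥤ Ext.{v, u} A k :=
  (isExt.{v, u} A k).lift
    ((isExt.{v, u} A (k + 1)).ι ⋙ (ker (Arr.{v, u} A k) : Arrow (Arr.{v, u} A k) ⥤ _))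
    (fun f => kernelsIn_isExt A k _ _ ⟨kernel.condition _, fun _ t ht =>
      ⟨kernel.lift _ t ht, kernel.lift_ι _ _ _, fun _ hy =>
        equalizer.hom_ext (hy.trans (kernel.lift_ι _ _ _).symm)⟩⟩ f.property)

end Tower

section Reflector

variable {C : Type u} [Category.{v} C] [HasZeroMorphisms C]
  (B : ObjectProperty C) [Reflective B.ι]

/-- The reflector onto `B`, viewed as an endofunctor of the category. -/
def I₀ : C ⥤ C := reflector B.ι ⋙ B.ι

/-- The unit `η` of the reflection. -/
def η₀ : 𝟭 C ⟶ I₀ B := (reflectorAdjunction B.ι).unit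

/-- The functor `J`, `X ↦ K[η_X]`. -/
noncomputable def J₀ [HasFiniteLimits C] : C ⥤ C where
  obj X := kernel ((η₀ B).app X)
  map f := kernel.map _ _ f ((I₀ B).map f) ((η₀ B).naturality f).symm
  map_id X := equalizer.hom_ext ((kernel.lift_ι _ _ _).trans
    ((Category.comp_id _).trans (Category.id_comp _).symm))
  map_comp f g := equalizer.hom_ext (by simp)

/-- The inclusion `μ : J ⟶ 𝟭`. -/
noncomputable def μ₀ [HasFiniteLimits C] : J₀ B ⟶ 𝟭 C where
  app X := kernel.ι ((η₀ B).app X)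
  naturality _ _ _ := kernel.lift_ι _ _ _

theorem isNormalTrans_μ₀ [HasFiniteLimits C] : IsNormalTrans (μ₀ B) :=
  fun X => ⟨_, (η₀ B).app X, kernel.condition _, fun _ t ht =>
    ⟨kernel.lift _ t ht, kernel.lift_ι _ _ _, fun _ hy =>
      equalizer.hom_ext (hy.trans (kernel.lift_ι _ _ _).symm)⟩⟩

end Reflector

section Homology

variable {A : Type (max u v)} [Category.{v} A] [HasZeroObject A] [HasZeroMorphisms A]
  (B : ObjectProperty A) [Reflective B.ι]

/-- The functors `J_k`, defined on all `k`-dimensional arrows: `J_0 = J`, and `J_{k+1}` maps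
`f : X ⟶ Y` to `K[J_k π₁] ⟶ 0`. -/
noncomputable def J [HasFiniteLimits A] : ∀ k, Arr.{v, u} A k ⥤ Arr.{v, u} A k
  | 0 => J₀ (C := A) B
  | k + 1 => nextJ (C := Arr.{v, u} A k) (J k)

/-- The inclusions `μ^k : J_k ⟶ 𝟭`. -/
noncomputable def μ [HasFiniteLimits A] : ∀ k, J.{v, u} B k ⟶ 𝟭 (Arr.{v, u} A k)
  | 0 => μ₀ (C := A) B
  | k + 1 => nextμ (C := Arr.{v, u} A k) (μ k)

variable [BarrExact A]

theorem exists_sparse : ∀ k, ∃ (S : ObjectProperty (Arr.{v, u} A k))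
    (T : MorphismProperty (Arr.{v, u} A k)), SubobjectsIn S ∧ CokernelsIn S T ∧
      QuotStable T (extMor.{v, u} A k) ∧ ∀ X, S ((J.{v, u} B k).obj X)
  | 0 => ⟨⊤, MorphismProperty.regularEpi A, fun _ _ _ _ _ => trivial,
      cokernelsIn_regularEpi (C := A), quotStable_regularEpi (C := A), fun _ => trivial⟩
  | k + 1 => by
    obtain ⟨S, T, h₁, h₂, h₃, h₄⟩ := exists_sparse k
    exact ⟨nextSparse S, nextQuot T, subobjectsIn_nextSparse h₁, cokernelsIn_nextQuot h₂,
      quotStable_doubleExt (stablePair_isExt A k) h₃, fun f => nextSparse_nextJ h₁ h₄ f⟩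

variable [Protomodular A]

theorem arr_hasNormalImages : ∀ k, HasNormalImages (Arr.{v, u} A k)
  | 0 => hasNormalImages (C := A)
  | k + 1 => hasNormalImages_arrow (C := Arr.{v, u} A k) (arr_hasNormalImages k)

theorem isNormalTrans_μ : ∀ k, IsNormalTrans (C := Arr.{v, u} A k) (μ.{v, u} B k)
  | 0 => isNormalTrans_μ₀ (C := A) B
  | k + 1 => isNormalTrans_nextμ (C := Arr.{v, u} A k) (arr_hasNormalImages k)
      (isNormalTrans_μ k)

/-- The functors `I_k`: `I_0` is the reflector onto `B`, and `I_{k+1}` maps `f : X ⟶ Y` to its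
centralisation `X / J_{k+1}[f] ⟶ Y`. -/
noncomputable def I : ∀ k, Arr.{v, u} A k ⥤ Arr.{v, u} A k
  | 0 => I₀ (C := A) B
  | k + 1 => nextI (C := Arr.{v, u} A k) (μ.{v, u} B k)
      (hasCokernel_nextι (arr_hasNormalImages k) (isNormalTrans_μ B k))

theorem isExt_I : ∀ (k : ℕ) (X : Arr.{v, u} A k), isExt.{v, u} A k X →
    isExt.{v, u} A k ((I.{v, u} B k).obj X)
  | 0, _, _ => trivial
  | k + 1, f, hf => by
    obtain ⟨S, T, h₁, h₂, h₃, h₄⟩ := exists_sparse B k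
    exact mem_nextI h₁ h₂ h₃ h₄ _ _ f hf

/-- The centralisation functor `I_k : Ext^k A ⥤ Ext^k A`. -/
noncomputable def IExt (k : ℕ) : Ext.{v, u} A k ⥤ Ext.{v, u} A k :=
  (isExt.{v, u} A k).lift ((isExt.{v, u} A k).ι ⋙ I.{v, u} B k)
    (fun X => isExt_I B k X.obj X.property)

/-- `IsHomology B n k H` says that `H` is the homology functor
`H_{n+1}(-, I_k) : Ext^k A ⥤ Ext^k A`. For `n = 0` this is `I_k`; and `H_{n+2}(-, I_k)` is the
pointwise left satellite of `H_{n+1}(-, I_{k+1})` relative to `cod` and `ker`, that is, the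
pointwise right Kan extension of `ker ∘ H_{n+1}(-, I_{k+1})` along `cod`. -/
def IsHomology : ∀ (n k : ℕ), (Ext.{v, u} A k ⥤ Ext.{v, u} A k) → Prop
  | 0, k, H => Nonempty (H ≅ IExt.{v, u} B k)
  | n + 1, k, H => ∃ H' : Ext.{v, u} A (k + 1) ⥤ Ext.{v, u} A (k + 1), IsHomology n (k + 1) H' ∧
      ∃ δ : cod.{v, u} A k ⋙ H ⟶ H' ⋙ kerExt.{v, u} A k,
        Nonempty (Functor.RightExtension.mk H δ).IsPointwiseRightKanExtension

/-- The iterated codomain functor `cod^n : Ext^{k+n} A ⥤ Ext^k A`. -/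
def codIter (A : Type (max u v)) [Category.{v} A] [HasZeroObject A]
    [HasZeroMorphisms A] [Regular A] (k : ℕ) :
    ∀ n : ℕ, Ext.{v, u} A (k + n) ⥤ Ext.{v, u} A k
  | 0 => 𝟭 _
  | n + 1 => cod.{v, u} A (k + n) ⋙ codIter A k n

/-- The iterated kernel functor `ker^n : Ext^{k+n} A ⥤ Ext^k A`. -/
noncomputable def kerIter (A : Type (max u v)) [Category.{v} A] [HasZeroObject A]
    [HasZeroMorphisms A] [Regular A] (k : ℕ) :
    ∀ n : ℕ, Ext.{v, u} A (k + n) ⥤ Ext.{v, u} A k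
  | 0 => 𝟭 _
  | n + 1 => kerExt.{v, u} A (k + n) ⋙ kerIter A k n

/-- The diagram `ker^n ∘ I_{k+n} ∘ U : (X ↓ cod^n) ⥤ Ext^k A`. -/
noncomputable def homologyDiagram (n k : ℕ) (X : Ext.{v, u} A k) :
    StructuredArrow X (codIter.{v, u} A k n) ⥤ Ext.{v, u} A k :=
  StructuredArrow.proj X (codIter.{v, u} A k n) ⋙ IExt.{v, u} B (k + n) ⋙ kerIter.{v, u} A k n

/-- An object of `A`, viewed as a `0`-extension. -/
def toExt (X : A) : Ext.{v, u} A 0 := ⟨X, trivial⟩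

/-- The object of `A` underlying a `0`-extension. -/
def ofExt (X : Ext.{v, u} A 0) : A := X.obj

end Homology

end SatelliteHomology

universe w w'

namespace SatelliteHomology

/-! ### Normal epimorphisms in a pointed regular protomodular category -/

section NormalEpimorphisms

variable {C : Type u} [Category.{v} C] [HasZeroMorphisms C]

/-! The heart is that the total kernel `ker^k (I_k f)` lies in `B` for every `k`-extension `f`, by
induction on `k`. For `k = 0` it is a reflection. For a `(k+1)`-extension `f`, embed `K[f]` in
`R[f]` as the kernel of the first projection. Since `μ^k` is a natural monomorphism, `J_{k+1}[f] =
K[J_k π₁]` is the intersection of `K[f]` with `J_k R[f]`. The kernel of `I_{k+1} f` is the quotient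
of `K[f]` by this intersection, so, as in the second isomorphism theorem, it embeds in `R[f] / J_k
R[f]`, hence in `I_k R[f]` (`exists_mono_kernel_nextI`). Now `R[f]` is a `k`-extension and `ker^k`
preserves monomorphisms, so `ker^{k+1} (I_{k+1} f)` is a subobject of `ker^k (I_k R[f])`, which is
in `B` by induction (`kerTotal_IExt`).

The rest is about limits. `B` is closed under every limit that exists (`Birkhoff.of_isLimit`), which
settles the single limit over `A ↓ cod^n` directly. For the homology functors, each kernel functor
is right adjoint to `X ↦ (X ⟶ 0)`, so `ker^k` preserves the limits that define the pointwise Kan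
extensions; induction on the homological degree, for all `k` at once, puts `ker^k` of every homology
object in `B` (`kerTotal_homology`). The case `k = 0` is the claim. -/

theorem IsKer.mono {N X Y : C} {n : N ⟶ X} {f : X ⟶ Y} (h : IsKer n f) : Mono n :=
  ⟨fun a b e => (h.2 (b ≫ n) (by rw [Category.assoc, h.1, comp_zero])).unique e rfl⟩

theorem isKer_kernel {X Y : C} (f : X ⟶ Y) [HasKernel f] : IsKer (kernel.ι f) f :=
  ⟨kernel.condition _, fun _ t ht => ⟨kernel.lift _ t ht, kernel.lift_ι _ _ _, fun _ hy =>
    equalizer.hom_ext (hy.trans (kernel.lift_ι _ _ _).symm)⟩⟩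

theorem isCoker_cokernel {X Y : C} (f : X ⟶ Y) [HasCokernel f] : IsCoker f (cokernel.π f) :=
  ⟨cokernel.condition _, fun _ t ht => ⟨cokernel.desc _ t ht, cokernel.π_desc _ _ _, fun _ hy =>
    coequalizer.hom_ext (hy.trans (cokernel.π_desc _ _ _).symm)⟩⟩

theorem IsCoker.isRegularEpi {X Y Q : C} {f : X ⟶ Y} {q : Y ⟶ Q} (h : IsCoker f q) :
    IsRegularEpi q := by
  choose d hd hd' using h.2
  have : IsColimit (CokernelCofork.ofπ q h.1) :=
    CokernelCofork.IsColimit.ofπ q h.1 (fun g hg => d g hg)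
      (fun g hg => hd g hg) (fun g hg m hm => hd' g hg m hm)
  exact ⟨⟨Cofork.IsColimit.regularEpi this⟩⟩

/-- Normal epimorphisms are stable under pullback. -/
def NormalEpiPullback (C : Type u) [Category.{v} C] [HasZeroMorphisms C] : Prop :=
  ∀ ⦃M X Q K K' N : C⦄ (m : M ⟶ X) (q : X ⟶ Q) (i : K ⟶ X) (e : K ⟶ K') (j : K' ⟶ Q)
    (n : N ⟶ K), IsCoker m q → IsPullback i e q j → IsKer n e → IsCoker n e

/-- If a map has the same kernel as a normal epimorphism through which it
factors, then the induced map is a monomorphism. -/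
def NormalEpiMono (C : Type u) [Category.{v} C] [HasZeroMorphisms C] : Prop :=
  ∀ ⦃M K K' Z : C⦄ (m : M ⟶ K) (e : K ⟶ K') (h : K' ⟶ Z), IsCoker m e → IsKer m (e ≫ h) → Mono h

/-- A regular epimorphism in a pointed protomodular category is the cokernel of its kernel. -/
theorem isCoker_of_isRegularEpi [HasFiniteLimits C] [Protomodular C] [HasZeroObject C]
    {N X Y : C} (n : N ⟶ X) (f : X ⟶ Y) [IsRegularEpi f] (h : IsKer n f) : IsCoker n f := by
  refine ⟨h.1, fun T t ht => ?_⟩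
  have hs : pullback.lift (f := f) (g := f) (𝟙 X) (𝟙 X) rfl ≫ pullback.fst f f = 𝟙 X :=
    pullback.lift_fst _ _ _
  have hs' : pullback.lift (f := f) (g := f) (𝟙 X) (𝟙 X) rfl ≫ pullback.snd f f = 𝟙 X :=
    pullback.lift_snd _ _ _
  -- `f` is the coequalizer of its kernel pair, so `t` only has to coequalize the projections. By
  -- protomodularity this may be tested on the diagonal and on the kernel of the first projection.
  -- On that kernel the second projection lands in `K[f]`, which `t` kills.
  have hR : pullback.fst f f ≫ t = pullback.snd f f ≫ t := by
    refine eq_of_factors (pullback.fst f f) _ hs (0 : (0 : C) ⟶ X) _ _ ?_ ?_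
    · rw [reassoc_of% hs, reassoc_of% hs']
    · have h₀ : pullback.fst (pullback.fst f f) (0 : (0 : C) ⟶ X) ≫ pullback.fst f f = 0 := by
        rw [pullback.condition, comp_zero]
      obtain ⟨r, hr, -⟩ := h.2 (pullback.fst (pullback.fst f f) (0 : (0 : C) ⟶ X) ≫
        pullback.snd f f) (by
          rw [Category.assoc, ← pullback.condition, reassoc_of% h₀, zero_comp])
      rw [reassoc_of% h₀, zero_comp, ← Category.assoc, ← hr, Category.assoc, ht, comp_zero]
  have E := (IsKernelPair.of_hasPullback f).toCoequalizer'
  exact ⟨Cofork.IsColimit.desc E t hR, Cofork.IsColimit.π_desc' E t hR, fun y hy =>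
    Cofork.IsColimit.hom_ext E (hy.trans (Cofork.IsColimit.π_desc' E t hR).symm)⟩

/-- Cokernels are regular epimorphisms, these are stable under pullback in a regular category, and
each of them is again the cokernel of its kernel. -/
theorem normalEpiPullback [Regular C] [Protomodular C] [HasZeroObject C] :
    NormalEpiPullback C := by
  intro M X Q K K' N m q i e j n hq hp hn
  have := hq.isRegularEpi
  have : IsRegularEpi e := by
    have h := (stablePair_regularEpi (C := C)).baseChange hp
      ((MorphismProperty.regularEpi_iff q).2 inferInstance) trivial
    exact (MorphismProperty.regularEpi_iff e).1 h
  exact isCoker_of_isRegularEpi n e hn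

/-- In a pointed protomodular category, maps with trivial kernel are monomorphisms. -/
theorem mono_of_kernel_zero [HasFiniteLimits C] [Protomodular C] [HasZeroObject C] {X Y : C}
    (f : X ⟶ Y) (h : ∀ ⦃T : C⦄ (t : T ⟶ X), t ≫ f = 0 → t = 0) : Mono f := by
  have hs : pullback.lift (f := f) (g := f) (𝟙 X) (𝟙 X) rfl ≫ pullback.fst f f = 𝟙 X :=
    pullback.lift_fst _ _ _
  have hs' : pullback.lift (f := f) (g := f) (𝟙 X) (𝟙 X) rfl ≫ pullback.snd f f = 𝟙 X :=
    pullback.lift_snd _ _ _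
  -- Equality of the two projections of the kernel pair is again tested on the diagonal and on the
  -- kernel of the first projection; there the second projection has image in the trivial kernel of
  -- `f`.
  have hR : pullback.fst f f = pullback.snd f f := by
    refine eq_of_factors (pullback.fst f f) _ hs (0 : (0 : C) ⟶ X) _ _ (hs.trans hs'.symm) ?_
    have h₀ : pullback.fst (pullback.fst f f) (0 : (0 : C) ⟶ X) ≫ pullback.fst f f = 0 := by
      rw [pullback.condition, comp_zero]
    rw [h₀, h (_ ≫ pullback.snd f f)]
    rw [Category.assoc, ← pullback.condition, reassoc_of% h₀, zero_comp]
  refine ⟨fun a b e => ?_⟩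
  rw [← pullback.lift_fst a b e, hR, pullback.lift_snd]

/-- By lifting elements: what `h` kills lifts, after pulling back along the regular epimorphism `e`,
to something that `e ≫ h` kills. This lift comes from `m`, so `e` kills it too, and the kernel of
`h` is trivial. -/
theorem normalEpiMono [Regular C] [Protomodular C] [HasZeroObject C] : NormalEpiMono C := by
  intro M K K' Z m e h he hm
  refine mono_of_kernel_zero h fun T t ht => ?_
  have := he.isRegularEpi
  obtain ⟨r, hr, -⟩ := hm.2 (pullback.fst e t) (by
    rw [pullback.condition_assoc, ht, comp_zero])
  rw [← cancel_epi (pullback.snd e t), ← pullback.condition, ← hr, Category.assoc, he.1,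
    comp_zero, comp_zero]

end NormalEpimorphisms

/-! ### Passage to arrow categories, component by component -/

section Arrows

variable {C : Type u} [Category.{v} C]

theorem mono_left {X Y : Arrow C} (f : X ⟶ Y) [Mono f] : Mono f.left :=
  ⟨fun {T} a b e => by
    obtain ⟨a, rfl⟩ := exists_hom_left X a
    obtain ⟨b, rfl⟩ := exists_hom_left X b
    exact congrArg CommaMorphism.left ((cancel_mono f).1 (ext_left Y _ _ e))⟩

theorem mono_of_components {X Y : Arrow C} (f : X ⟶ Y) (hl : Mono f.left) (hr : Mono f.right) :
    Mono f :=
  ⟨fun _ _ e => Arrow.hom_ext _ _ ((cancel_mono f.left).1 (congrArg CommaMorphism.left e))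
    ((cancel_mono f.right).1 (congrArg CommaMorphism.right e))⟩

variable [HasZeroMorphisms C]

theorem IsKer.left {N X Y : Arrow C} {n : N ⟶ X} {f : X ⟶ Y} (h : IsKer n f) :
    IsKer n.left f.left := by
  refine ⟨congrArg CommaMorphism.left h.1, fun T t ht => ?_⟩
  obtain ⟨t, rfl⟩ := exists_hom_left X t
  obtain ⟨r, hr, hr'⟩ := h.2 t (ext_left _ _ _ ht)
  refine ⟨r.left, congrArg CommaMorphism.left hr, fun y hy => ?_⟩
  obtain ⟨y, rfl⟩ := exists_hom_left N y
  exact congrArg CommaMorphism.left (hr' y (ext_left _ _ _ hy))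

theorem IsKer.right [HasZeroObject C] {N X Y : Arrow C} {n : N ⟶ X} {f : X ⟶ Y}
    (h : IsKer n f) : IsKer n.right f.right := by
  refine ⟨congrArg CommaMorphism.right h.1, fun T t ht => ?_⟩
  obtain ⟨t, rfl⟩ := exists_hom_right X t
  obtain ⟨r, hr, hr'⟩ := h.2 t (ext_right _ _ _ ht)
  refine ⟨r.right, congrArg CommaMorphism.right hr, fun y hy => ?_⟩
  obtain ⟨y, rfl⟩ := exists_hom_right N y
  exact congrArg CommaMorphism.right (hr' y (ext_right _ _ _ hy))

/-- The domain functor is left adjoint to `T ↦ (T ⟶ 0)`, so it preserves cokernels. -/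
theorem IsCoker.left [HasZeroObject C] {X Y Q : Arrow C} {f : X ⟶ Y} {q : Y ⟶ Q}
    (h : IsCoker f q) : IsCoker f.left q.left := by
  refine ⟨congrArg CommaMorphism.left h.1, fun T t ht => ?_⟩
  let u : Y ⟶ Arrow.mk (0 : T ⟶ (0 : C)) := Arrow.homMk t 0 (by simp)
  obtain ⟨d, hd, hd'⟩ := h.2 u (Arrow.hom_ext _ _ ht ((isZero_zero C).eq_of_tgt _ _))
  refine ⟨d.left, congrArg CommaMorphism.left hd, fun y hy => ?_⟩
  let y' : Q ⟶ Arrow.mk (0 : T ⟶ (0 : C)) := Arrow.homMk y 0 (by simp)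
  exact congrArg CommaMorphism.left
    (hd' y' (Arrow.hom_ext _ _ hy ((isZero_zero C).eq_of_tgt _ _)))

/-- The codomain functor is left adjoint to `T ↦ 𝟙 T`, so it preserves cokernels. -/
theorem IsCoker.right {X Y Q : Arrow C} {f : X ⟶ Y} {q : Y ⟶ Q}
    (h : IsCoker f q) : IsCoker f.right q.right := by
  refine ⟨congrArg CommaMorphism.right h.1, fun T t ht => ?_⟩
  let u : Y ⟶ Arrow.mk (𝟙 T) := Arrow.homMk (Y.hom ≫ t) t (by simp)
  obtain ⟨d, hd, hd'⟩ := h.2 u (Arrow.hom_ext _ _ (by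
    change f.left ≫ Y.hom ≫ t = 0
    rw [← Category.assoc, Arrow.w f, Category.assoc, ht, comp_zero]) ht)
  refine ⟨d.right, congrArg CommaMorphism.right hd, fun y hy => ?_⟩
  let y' : Q ⟶ Arrow.mk (𝟙 T) := Arrow.homMk (Q.hom ≫ y) y (by simp)
  refine congrArg CommaMorphism.right (hd' y' (Arrow.hom_ext _ _ ?_ hy))
  change q.left ≫ Q.hom ≫ y = Y.hom ≫ t
  rw [← Category.assoc, Arrow.w q, Category.assoc, hy]

theorem isCoker_arrow {X Y Q : Arrow C} (f : X ⟶ Y) (q : Y ⟶ Q) (hl : IsCoker f.left q.left)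
    (hr : IsCoker f.right q.right) : IsCoker f q := by
  refine ⟨Arrow.hom_ext _ _ hl.1 hr.1, fun T t ht => ?_⟩
  obtain ⟨a, ha, ha'⟩ := hl.2 t.left (congrArg CommaMorphism.left ht)
  obtain ⟨b, hb, hb'⟩ := hr.2 t.right (congrArg CommaMorphism.right ht)
  have hab : a ≫ T.hom = Q.hom ≫ b := by
    refine (hl.2 (t.left ≫ T.hom) ?_).unique ?_ ?_
    · have : f.left ≫ t.left = 0 := congrArg CommaMorphism.left ht
      rw [← Category.assoc, this, zero_comp]
    · rw [reassoc_of% ha]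
    · rw [← Category.assoc, Arrow.w q, Category.assoc, hb, Arrow.w t]
  exact ⟨Arrow.homMk a b hab, Arrow.hom_ext _ _ ha hb, fun y hy => Arrow.hom_ext _ _
    (ha' _ (congrArg CommaMorphism.left hy)) (hb' _ (congrArg CommaMorphism.right hy))⟩

theorem mono_ker_map [HasKernels C] {f g : Arrow C} (φ : f ⟶ g) [Mono φ] :
    Mono ((ker C).map φ) := by
  have h₁ := mono_left φ
  have h₂ := (isKer_kernel f.hom).mono
  have e : (ker C).map φ ≫ kernel.ι g.hom = kernel.ι f.hom ≫ φ.left := kernel.lift_ι _ _ _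
  have : Mono ((ker C).map φ ≫ kernel.ι g.hom) := by
    rw [e]
    exact ⟨fun a b w => (cancel_mono (kernel.ι f.hom)).1 ((cancel_mono φ.left).1
      ((Category.assoc _ _ _).trans (w.trans (Category.assoc _ _ _).symm)))⟩
  exact mono_of_mono _ (kernel.ι g.hom)

variable [HasZeroObject C]

/-- Kernels, cokernels and pullbacks of arrows are all componentwise. This is what lets the two
properties of `A` climb to every `Arr^k A`. -/
theorem normalEpiPullback_arrow (h : NormalEpiPullback C) : NormalEpiPullback (Arrow C) := by
  intro M X Q K K' N m q i e j n hq hp hn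
  exact isCoker_arrow n e (h _ _ _ _ _ _ hq.left (isPullback_left hp) hn.left)
    (h _ _ _ _ _ _ hq.right (isPullback_right hp) hn.right)

theorem normalEpiMono_arrow (h : NormalEpiMono C) : NormalEpiMono (Arrow C) := by
  intro M K K' Z m e k he hm
  exact mono_of_components k (h _ _ _ he.left hm.left) (h _ _ _ he.right hm.right)

end Arrows

/-! ### The kernel of a centralisation -/

section Centralisation

variable {C : Type u} [Category.{v} C] [HasFiniteLimits C] [HasZeroMorphisms C]
  {J : C ⥤ C} {μ : J ⟶ 𝟭 C}

/-- Some cokernel of `nextι μ f` has it as kernel; that cokernel factors through the chosen one, so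
whatever the chosen one kills comes from `nextι μ f`. -/
theorem isKer_cokernel_π (hC : HasNormalImages C) (hμ : IsNormalTrans μ) (f : Arrow C)
    [HasCokernel (nextι μ f)] : IsKer (nextι μ f) (cokernel.π (nextι μ f)) := by
  obtain ⟨Q, q, hq, hk⟩ := exists_isCoker hC hμ f
  refine ⟨cokernel.condition _, fun T t ht => hk.2 t ?_⟩
  rw [← cokernel.π_desc (nextι μ f) q hq.1, reassoc_of% ht, zero_comp]

variable [HasZeroObject C]

/-- The kernel of the centralisation of `f` embeds into the quotient by `J` of the kernel pair
of `f`. -/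
theorem exists_mono_kernel_nextI (hC : HasNormalImages C) (hμ : IsNormalTrans μ)
    (hp : NormalEpiPullback C) (hm : NormalEpiMono C) (hc : ∀ f, HasCokernel (nextι μ f))
    (f : Arrow C) {Z : C} (h : pullback f.hom f.hom ⟶ Z)
    (hh : IsKer (μ.app (pullback f.hom f.hom)) h) :
    ∃ k : (ker C).obj ((nextI μ hc).obj f) ⟶ Z, Mono k := by
  have hk := isKer_cokernel_π hC hμ f
  have hkm := hk.mono
  let d : cokernel (nextι μ f) ⟶ f.right := cokernel.desc (nextι μ f) f.hom (nextι_comp μ f)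
  have hd : cokernel.π (nextι μ f) ≫ d = f.hom := cokernel.π_desc _ _ _
  -- Here `d` is the centralisation of `f`, and `e` restricts the quotient map to the kernels of `f`
  -- and `d`. As a pullback of a normal epimorphism, `e` will present `K[d]` as a quotient of
  -- `K[f]`.
  let e : kernel f.hom ⟶ kernel d := kernel.lift _ (kernel.ι f.hom ≫ cokernel.π _)
    (by rw [Category.assoc, hd, kernel.condition])
  have he : e ≫ kernel.ι d = kernel.ι f.hom ≫ cokernel.π (nextι μ f) := kernel.lift_ι _ _ _
  have hP : IsPullback (kernel.ι f.hom) e (cokernel.π (nextι μ f)) (kernel.ι d) := by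
    rw [isPullback_iff]
    refine ⟨he.symm, fun T s t w => ?_⟩
    have hs : s ≫ f.hom = 0 := by
      rw [← hd, reassoc_of% w, kernel.condition, comp_zero]
    refine ⟨kernel.lift _ s hs, ⟨kernel.lift_ι _ _ _, ?_⟩, fun y hy => ?_⟩
    · rw [← cancel_mono (kernel.ι d), Category.assoc, he, kernel.lift_ι_assoc, w]
    · rw [← cancel_mono (kernel.ι f.hom), hy.1, kernel.lift_ι]
  let m : kernel (J.map (pullback.fst f.hom f.hom)) ⟶ kernel f.hom :=
    kernel.lift _ (nextι μ f) (nextι_comp μ f)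
  have hmι : m ≫ kernel.ι f.hom = nextι μ f := kernel.lift_ι _ _ _
  have hme : IsKer m e := by
    refine ⟨?_, fun T t ht => ?_⟩
    · rw [← cancel_mono (kernel.ι d), Category.assoc, he, reassoc_of% hmι, hk.1, zero_comp]
    · obtain ⟨r, hr, hr'⟩ := hk.2 (t ≫ kernel.ι f.hom) (by
        rw [Category.assoc, ← he, reassoc_of% ht, zero_comp])
      refine ⟨r, ?_, fun y hy => hr' y ?_⟩
      · change r ≫ m = t
        rw [← cancel_mono (kernel.ι f.hom), Category.assoc, hmι, hr]
      · rw [← hmι, ← hy, Category.assoc]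
  have hcoker : IsCoker m e := hp _ _ _ _ _ _ (isCoker_cokernel (nextι μ f)) hP hme
  -- The embedding `x ↦ (0, x)` of `K[f]` in the kernel pair, as the kernel of the first projection.
  let ν : kernel f.hom ⟶ pullback f.hom f.hom := pullback.lift 0 (kernel.ι f.hom)
    (by rw [zero_comp, kernel.condition])
  have hν : ν ≫ pullback.fst f.hom f.hom = 0 := pullback.lift_fst _ _ _
  have hν' : ν ≫ pullback.snd f.hom f.hom = kernel.ι f.hom := pullback.lift_snd _ _ _
  have hmν : m ≫ ν = kernel.ι (J.map (pullback.fst f.hom f.hom)) ≫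
      μ.app (pullback f.hom f.hom) := by
    apply pullback.hom_ext
    · rw [nextι_fst, Category.assoc, hν, comp_zero]
    · rw [← nextι_eq, Category.assoc, hν', hmι]
  -- The intersection formula: an element of `K[f]` whose image under `ν` lies in `J R[f]` already
  -- lies in `K[J π₁]`.
  have hg : IsKer m (ν ≫ h) := by
    refine ⟨?_, fun T t ht => ?_⟩
    · rw [reassoc_of% hmν]
      exact (congrArg _ hh.1).trans comp_zero
    · obtain ⟨a, ha, -⟩ := hh.2 (t ≫ ν) (by rw [Category.assoc, ht])
      obtain ⟨Z', h', hh'⟩ := hμ f.left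
      have hn := μ.naturality (pullback.fst f.hom f.hom)
      rw [Functor.id_map] at hn
      -- `μ` at `f.left` is a monomorphism, and by naturality it sends `J π₁ ∘ a` to `π₁ ∘ ν ∘ t =
      -- 0`.
      have hz : a ≫ J.map (pullback.fst f.hom f.hom) = 0 := by
        refine (hh'.2 0 zero_comp).unique ?_ zero_comp
        rw [Category.assoc, hn]
        refine (Category.assoc _ _ _).symm.trans ((congrArg (· ≫ _) ha).trans ?_)
        exact (Category.assoc _ _ _).trans ((congrArg (t ≫ ·) hν).trans comp_zero)
      have hmm : Mono m := by
        have : Mono (m ≫ kernel.ι f.hom) := by rwa [hmι]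
        exact mono_of_mono _ (kernel.ι f.hom)
      have key : kernel.lift _ a hz ≫ m = t := by
        rw [← cancel_mono (kernel.ι f.hom), ← hν', Category.assoc, reassoc_of% hmν,
          kernel.lift_ι_assoc]
        exact (Category.assoc _ _ _).symm.trans
          ((congrArg (· ≫ _) ha).trans (Category.assoc _ _ _))
      exact ⟨_, key, fun y hy => (cancel_mono m).1 (hy.trans key.symm)⟩
  -- `k` is the map that `ν ≫ h` induces on the quotient `K[d]`; it is a monomorphism because `e`
  -- and `e ≫ k` share the kernel `m`.
  obtain ⟨k, hk₁, -⟩ := hcoker.2 (ν ≫ h) hg.1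
  exact ⟨k, hm m e k hcoker (by rwa [hk₁])⟩

/-- The quotient map from `f` to its centralisation is the identity on codomains, where `nextJ` has
a zero object. It provides the map `h` that `exists_mono_kernel_nextI` needs one dimension higher.
-/
theorem exists_isKer_nextμ (hC : HasNormalImages C) (hμ : IsNormalTrans μ)
    (hc : ∀ f, HasCokernel (nextι μ f)) (f : Arrow C) :
    ∃ h : f ⟶ (nextI μ hc).obj f, IsKer ((nextμ μ).app f) h := by
  refine ⟨Arrow.homMk (cokernel.π (nextι μ f)) (𝟙 _)
    ((cokernel.π_desc _ _ _).trans (Category.comp_id _).symm),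
    isKer_arrow _ _ (isKer_cokernel_π hC hμ f) ⟨zero_comp, fun T t ht => ⟨0, ?_,
      fun y _ => (isZero_zero C).eq_of_tgt _ _⟩⟩⟩
  exact comp_zero.trans (ht.symm.trans (Category.comp_id t))

end Centralisation

/-! ### Extensions over a zero object -/

section Zero

variable {C : Type u} [Category.{v} C] [HasZeroMorphisms C]

/-- The maps from objects in `P` to a zero object belong to `W`. -/
def ToZeroIn (P : ObjectProperty C) (W : MorphismProperty C) : Prop :=
  ∀ ⦃X Z : C⦄ (t : X ⟶ Z), IsZero Z → P X → W t

theorem toZeroIn_regularEpi : ToZeroIn (⊤ : ObjectProperty C) (MorphismProperty.regularEpi C) := by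
  intro X Z t hZ _
  rw [MorphismProperty.regularEpi_iff]
  have : IsSplitEpi t := ⟨⟨0, hZ.eq_of_tgt _ _⟩⟩
  infer_instance

theorem toZeroIn_doubleExt [HasFiniteLimits C] [HasZeroObject C] {P : ObjectProperty C}
    {W : MorphismProperty C} (h : StablePair P W) (h₀ : ToZeroIn P W) :
    ToZeroIn (fun f : Arrow C => W f.hom) (doubleExt W) := by
  intro f z t hz hf
  have hl : IsZero z.left := (IsZero.iff_id_eq_zero _).2
    (congrArg CommaMorphism.left (hz.eq_of_src (𝟙 z) 0))
  have hr : IsZero z.right := (IsZero.iff_id_eq_zero _).2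
    (congrArg CommaMorphism.right (hz.eq_of_src (𝟙 z) 0))
  have htl : W t.left := h₀ _ hl (h.src _ hf)
  refine ⟨hf, h₀ _ hr (h.tgt _ htl), htl, h₀ _ hr (h.tgt _ hf), ?_⟩
  have : IsIso z.hom := ⟨0, hl.eq_of_src _ _, hr.eq_of_src _ _⟩
  -- Since `z.hom` is an isomorphism, the pullback is isomorphic to the codomain of `f`, and the
  -- comparison map becomes `f.hom` itself.
  have e : pullback.lift (f := z.hom) (g := t.right) t.left f.hom (Arrow.w t) =
      f.hom ≫ inv (pullback.snd z.hom t.right) := by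
    rw [IsIso.eq_comp_inv, pullback.lift_snd]
  rw [e]
  exact h.comp_iso _ _ hf

end Zero

/-! ### Kernel functors on higher extensions -/

section Tower

variable (A : Type (max u v)) [Category.{v} A] [HasZeroMorphisms A] [HasZeroObject A] [Regular A]

theorem arr_normalEpiPullback [Protomodular A] : ∀ k, NormalEpiPullback (Arr.{v, u} A k)
  | 0 => normalEpiPullback (C := A)
  | k + 1 => normalEpiPullback_arrow (C := Arr.{v, u} A k) (arr_normalEpiPullback k)

theorem arr_normalEpiMono [Protomodular A] : ∀ k, NormalEpiMono (Arr.{v, u} A k)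
  | 0 => normalEpiMono (C := A)
  | k + 1 => normalEpiMono_arrow (C := Arr.{v, u} A k) (arr_normalEpiMono k)

theorem arr_toZeroIn : ∀ k, ToZeroIn (C := Arr.{v, u} A k) (isExt.{v, u} A k) (extMor.{v, u} A k)
  | 0 => toZeroIn_regularEpi (C := A)
  | k + 1 => toZeroIn_doubleExt (C := Arr.{v, u} A k) (stablePair_isExt A k) (arr_toZeroIn k)

/-- The functor that sends a `k`-extension `X` to the `(k+1)`-extension `X ⟶ 0`. -/
noncomputable def toZeroExt (k : ℕ) : Ext.{v, u} A k ⥤ Ext.{v, u} A (k + 1) :=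
  (isExt.{v, u} A (k + 1)).lift ((isExt.{v, u} A k).ι ⋙ toZero (Arr.{v, u} A k))
    (fun X => arr_toZeroIn A k _ (isZero_zero _) X.property)

/-- The functor `X ↦ (X ⟶ 0)` is left adjoint to the kernel functor. -/
noncomputable def toZeroAdjunction (C : Type u) [Category.{v} C] [HasZeroMorphisms C]
    [HasZeroObject C] [HasKernels C] : toZero C ⊣ ker C :=
  Adjunction.mkOfHomEquiv
    { homEquiv := fun X f =>
        { toFun := fun t => kernel.lift f.hom t.left
            ((Arrow.w t).trans zero_comp)
          invFun := fun t => Arrow.homMk (t ≫ kernel.ι f.hom) 0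
            (((Category.assoc _ _ _).trans (congrArg (t ≫ ·) (kernel.condition _))).trans
              (comp_zero.trans comp_zero.symm))
          left_inv := fun t => Arrow.hom_ext _ _ (kernel.lift_ι _ _ _)
            ((isZero_zero C).eq_of_src _ _)
          right_inv := fun t => equalizer.hom_ext (kernel.lift_ι _ _ _) }
      homEquiv_naturality_left_symm := fun f g => Arrow.hom_ext _ _ (Category.assoc _ _ _)
        ((isZero_zero C).eq_of_src _ _)
      homEquiv_naturality_right := fun {X f g} t φ => by
        apply equalizer.hom_ext
        have h₁ : (ker C).map φ ≫ kernel.ι g.hom = kernel.ι f.hom ≫ φ.left := kernel.lift_ι _ _ _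
        have h₂ : kernel.lift f.hom t.left ((Arrow.w t).trans zero_comp) ≫ kernel.ι f.hom =
          t.left := kernel.lift_ι _ _ _
        refine (kernel.lift_ι _ _ _).trans ?_
        refine Eq.trans ?_ (Category.assoc _ _ _).symm
        refine Eq.trans ?_ (congrArg (_ ≫ ·) h₁).symm
        exact (congrArg (· ≫ φ.left) h₂).symm.trans (Category.assoc _ _ _) }

/-- The kernel functor between extensions is right adjoint to `X ↦ (X ⟶ 0)`. -/
noncomputable def toZeroExtAdjunction (k : ℕ) : toZeroExt.{v, u} A k ⊣ kerExt.{v, u} A k :=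
  (toZeroAdjunction (Arr.{v, u} A k)).restrictFullyFaithful
    (isExt.{v, u} A k).fullyFaithfulι (isExt.{v, u} A (k + 1)).fullyFaithfulι
    (Iso.refl _) (Iso.refl _)

/-- The total kernel functor `ker^k : Ext^k A ⥤ A`. -/
noncomputable def kerTotal : ∀ k, Ext.{v, u} A k ⥤ Ext.{v, u} A 0
  | 0 => 𝟭 _
  | k + 1 => kerExt.{v, u} A k ⋙ kerTotal k

theorem kerIter_zero : ∀ n, kerIter.{v, u} A 0 n = kerTotal.{v, u} A (0 + n)
  | 0 => rfl
  | n + 1 => congrArg (kerExt.{v, u} A (0 + n) ⋙ ·) (kerIter_zero n)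

/-- A composite of right adjoints. The size is left free because the comma categories indexing the
Kan extensions need not be small. -/
theorem preservesLimits_kerTotal : ∀ k,
    PreservesLimitsOfSize.{w, w'} (kerTotal.{v, u} A k)
  | 0 => inferInstanceAs (PreservesLimitsOfSize.{w, w'} (𝟭 (Ext.{v, u} A 0)))
  | k + 1 => by
    have := preservesLimits_kerTotal k
    have := (toZeroExtAdjunction.{v, u} A k).rightAdjoint_preservesLimits
    exact inferInstanceAs (PreservesLimitsOfSize.{w, w'} (kerExt.{v, u} A k ⋙ kerTotal.{v, u} A k))

/-- The monomorphism is required in `Arr^k A`, not merely in `Ext^k A`, as the arrow-level kernel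
functor carries the induction. -/
theorem mono_kerTotal_map : ∀ (k : ℕ) {X Y : Ext.{v, u} A k} (f : X ⟶ Y), Mono f.hom →
    Mono ((kerTotal.{v, u} A k).map f).hom
  | 0, _, _, _, h => h
  | k + 1, _, _, f, h => mono_kerTotal_map k ((kerExt.{v, u} A k).map f)
      (@mono_ker_map (Arr.{v, u} A k) _ _ _ _ _ f.hom h)

end Tower

/-! ### Limits in a Birkhoff subcategory -/

/-- A Birkhoff subcategory is closed under all limits that exist in the surrounding category. -/
theorem Birkhoff.of_isLimit {A : Type (max u v)} [Category.{v} A] [BarrExact A]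
    (B : ObjectProperty A) [Birkhoff B] {K : Type*} [Category* K]
    {F : K ⥤ Ext.{v, u} A 0} (hF : ∀ j, B (ofExt.{v, u} (F.obj j))) (c : Cone F) (hc : IsLimit c) :
    B (ofExt.{v, u} c.pt) := by
  let L : A := ofExt.{v, u} c.pt
  let adj := reflectorAdjunction B.ι
  -- The projections of the limit `L` end in objects of `B`, so each factors through the unit at
  -- `L`; uniqueness of the factorisations, `hu`, makes them a cone on `I L`.
  let l (j : K) : (I₀ B).obj L ⟶ ofExt.{v, u} (F.obj j) :=
    ((adj.homEquiv L ⟨_, hF j⟩).symm (c.π.app j).hom).hom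
  have hl (j : K) : (η₀ B).app L ≫ l j = (c.π.app j).hom :=
    (adj.homEquiv_unit L ⟨_, hF j⟩ _).symm.trans
      (Equiv.apply_symm_apply _ _)
  have hu {j : K} (a b : (I₀ B).obj L ⟶ ofExt.{v, u} (F.obj j))
      (h : (η₀ B).app L ≫ a = (η₀ B).app L ≫ b) : a = b := by
    let a' : (reflector B.ι).obj L ⟶ ⟨_, hF j⟩ := ObjectProperty.homMk a
    let b' : (reflector B.ι).obj L ⟶ ⟨_, hF j⟩ := ObjectProperty.homMk b
    have : adj.homEquiv L ⟨_, hF j⟩ a' = adj.homEquiv L ⟨_, hF j⟩ b' :=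
      (adj.homEquiv_unit L ⟨_, hF j⟩ a').trans (h.trans (adj.homEquiv_unit L ⟨_, hF j⟩ b').symm)
    exact congrArg (fun f => f.hom) ((adj.homEquiv L ⟨_, hF j⟩).injective this)
  let s : Cone F :=
    { pt := toExt.{v, u} ((I₀ B).obj L)
      π :=
        { app := fun j => ObjectProperty.homMk (l j)
          naturality := fun i j f => by
            refine (Category.id_comp _).trans ?_
            apply ObjectProperty.hom_ext
            apply hu
            refine (hl j).trans ?_
            refine Eq.trans ?_ (Category.assoc _ _ _)
            refine Eq.trans ?_ (congrArg (· ≫ _) (hl i)).symm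
            exact congrArg (fun f => f.hom) (c.w f).symm } }
  let r : c.pt ⟶ s.pt := ObjectProperty.homMk (show c.pt.obj ⟶ s.pt.obj from (η₀ B).app L)
  -- The map induced by this cone retracts the unit, so `L` is a subobject of `I L`, and closure
  -- under subobjects concludes.
  have hr : r ≫ hc.lift s = 𝟙 _ := by
    apply hc.hom_ext
    intro j
    rw [Category.assoc, hc.fac, Category.id_comp]
    exact ObjectProperty.hom_ext _ (hl j)
  have hr' : (η₀ B).app L ≫ (hc.lift s).hom = 𝟙 L := congrArg (fun f => f.hom) hr
  have : IsSplitMono ((η₀ B).app L) := ⟨⟨_, hr'⟩⟩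
  exact Birkhoff.of_mono ((η₀ B).app L) ((reflector B.ι).obj L).property

/-! ### Total kernels of centralisations and of homology -/

section Homology

variable {A : Type (max u v)} [Category.{v} A] [HasZeroObject A] [HasZeroMorphisms A]
  [BarrExact A] [Protomodular A] (B : ObjectProperty A)

theorem exists_isKer_μ [Reflective B.ι] : ∀ (k : ℕ) (X : Arr.{v, u} A k),
    ∃ h : X ⟶ (I.{v, u} B k).obj X, IsKer ((μ.{v, u} B k).app X) h
  | 0, X => ⟨(η₀ B).app X, isKer_kernel (C := A) _⟩
  | k + 1, f => exists_isKer_nextμ (C := Arr.{v, u} A k) (arr_hasNormalImages k)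
      (isNormalTrans_μ B k) _ f

variable [Birkhoff B]

/-- The total kernel of a centralised extension belongs to the Birkhoff subcategory. -/
theorem kerTotal_IExt : ∀ (k : ℕ) (X : Ext.{v, u} A k),
    B (ofExt.{v, u} ((kerTotal.{v, u} A k).obj ((IExt.{v, u} B k).obj X)))
  | 0, X => ((reflector B.ι).obj X.obj).property
  | k + 1, f => by
    let g : Arrow (Arr.{v, u} A k) := f.obj
    have hg : isExt.{v, u} A k g.left := (stablePair_isExt A k).src _ f.property
    -- The kernel pair is the domain of a base change of the extension `f`, so it is a `k`-extension
    -- and the induction hypothesis applies to it.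
    have hR : isExt.{v, u} A k (pullback g.hom g.hom) := (stablePair_isExt A k).src _
      ((stablePair_isExt A k).baseChange (IsPullback.of_hasPullback g.hom g.hom) f.property hg)
    obtain ⟨h, hh⟩ := exists_isKer_μ B k (pullback g.hom g.hom)
    obtain ⟨m, hm⟩ := exists_mono_kernel_nextI (C := Arr.{v, u} A k) (arr_hasNormalImages k)
      (isNormalTrans_μ B k) (arr_normalEpiPullback A k) (arr_normalEpiMono A k)
      (hasCokernel_nextι (arr_hasNormalImages k) (isNormalTrans_μ B k)) g h hh
    let m' : (kerExt.{v, u} A k).obj ((IExt.{v, u} B (k + 1)).obj f) ⟶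
        (IExt.{v, u} B k).obj ⟨_, hR⟩ := ObjectProperty.homMk m
    have := mono_kerTotal_map A k m' hm
    exact @Birkhoff.of_mono A _ B _ _ _ ((kerTotal.{v, u} A k).map m').hom this
      (kerTotal_IExt k ⟨_, hR⟩)

/-- The induction on `n` needs every `k`, as each step trades a degree for a dimension. The value at
`X` is a limit of kernels of the previous homology; `ker^k` preserves it, and the new terms are the
values of `ker^{k+1}` covered by induction. -/
theorem kerTotal_homology : ∀ (n k : ℕ) (H : Ext.{v, u} A k ⥤ Ext.{v, u} A k),
    IsHomology.{v, u} B n k H → ∀ X, B (ofExt.{v, u} ((kerTotal.{v, u} A k).obj (H.obj X)))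
  | 0, k, H, ⟨e⟩, X => by
    let i := (isExt.{v, u} A 0).ι.mapIso ((kerTotal.{v, u} A k).mapIso (e.app X))
    exact @Birkhoff.of_mono A _ B _ _ _ i.hom (inferInstanceAs (Mono i.hom)) (kerTotal_IExt B k X)
  | n + 1, k, H, ⟨H', hH', δ, ⟨hδ⟩⟩, X => by
    have := preservesLimits_kerTotal.{v, u, v, max u v} A k
    exact Birkhoff.of_isLimit B
      (fun j => kerTotal_homology n (k + 1) H' hH' j.right) _
      (isLimitOfPreserves (kerTotal.{v, u} A k) (hδ X))

end Homology

end SatelliteHomology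

theorem mainTheorem7 {A : Type (max u v)} [Category.{v} A] [HasZeroObject A]
    [HasZeroMorphisms A] [SatelliteHomology.BarrExact A] [SatelliteHomology.Protomodular A]
    (B : ObjectProperty A) [SatelliteHomology.Birkhoff B] (n : ℕ) (X : A) :
    (∀ H : SatelliteHomology.Ext.{v, u} A 0 ⥤ SatelliteHomology.Ext.{v, u} A 0,
      SatelliteHomology.IsHomology.{v, u} B n 0 H →
        B (SatelliteHomology.ofExt.{v, u} (H.obj (SatelliteHomology.toExt.{v, u} X)))) ∧
    (∀ c : Cone (SatelliteHomology.homologyDiagram.{v, u} B n 0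
        (SatelliteHomology.toExt.{v, u} X)),
      IsLimit c → B (SatelliteHomology.ofExt.{v, u} c.pt)) := by
  -- For `k = 0` the total kernel is the identity functor. The second limit is already formed in
  -- dimension `0`, so only the terms of its diagram need checking.
  refine ⟨fun H hH => SatelliteHomology.kerTotal_homology B n 0 H hH _, fun c hc =>
    SatelliteHomology.Birkhoff.of_isLimit B (fun j => ?_) c hc⟩
  change B (SatelliteHomology.ofExt.{v, u} ((SatelliteHomology.kerIter.{v, u} A 0 n).obj
    ((SatelliteHomology.IExt.{v, u} B (0 + n)).obj j.right)))
  rw [SatelliteHomology.kerIter_zero]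
  exact SatelliteHomology.kerTotal_IExt B (0 + n) j.right
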